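/- Rings are associative but need not have a unit. A \emph{set of local units} of a ring $A$ is a set $\mathsf{E}$ of idempotents of $A$ such that for every finite subset $F\subseteq A$ there is $e\in \mathsf{E}$ with $ea=ae=a$ for all $a\in F$. Let $R\subseteq S$ be an extension of rings with the same set of local units $\mathsf{E}$ (so $\mathsf{E}\subseteq R$ is a set of local units of $S$, hence of $R$). For $s\in S$ put $\mathrm{Unit}\{s\}=\{e\in\mathsf{E}: es=se=s\}$. A bimodule $M$ over $A\in\{R,S\}$ is \emph{unital} if for each $x\in M$ there are $e,e'\in\mathsf{E}$ with $ex=x=xe'$. Notation. \begin{itemize} \item $\mathrm{Pic}(A)$, for $A\in\{R,S\}$, is the group of isomorphism classes $[P]$ of unital $A$-bimodules $P$ for which there is a unital $A$-bimodule $Q$ with $P\otimes_A Q\cong A\cong Q\otimes_A P$ as bimodules; the product is $[P][P']=[P\otimes_A P']$ and the neutral element is $[A]$. \item $\mathrm{Inv}_R(S)$ is the group of unital $R$-subbimodules $X$ of $S$ for which there is an $R$-subbimodule $Y$ of $S$ with $XY=YX=R$, where $XY$ is the set of finite sums of products $xy$; the neutral element is $R$. \item $\mathrm{Aut}_{S\text{-}R}(S)$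 is the group of $S$-$R$-bilinear automorphisms of $S$ under composition, and $\mathrm{Aut}_{R\text{-rings}}(S)$ is the group of ring automorphisms of $S$ that are the identity on $R$. \item $\mathcal{D}:\mathrm{Aut}_{S\text{-}R}(S)\to \mathrm{Inv}_R(S)$ is the homomorphism $\lambda\mapsto\lambda^{-1}(R)$, and $\widehat{(-)}:\mathrm{Aut}_{S\text{-}R}(S)\to\mathrm{Aut}_{R\text{-rings}}(S)$ is the homomorphism $\lambda\mapsto\widehat\lambda$ with $\widehat\lambda(s)=\lambda^{-1}(e)\,s\,\lambda(e)$ for any $e\in\mathrm{Unit}\{s\}$. \item $\mathcal{M}(S/R)$ is the category whose objects $\phi:P\Rightarrow X$ consist of a unital $R$-bimodule $P$, a unital $S$-bimodule $X$ and an $R$-bilinear map $\phi:P\to X$ such that the maps $P\otimes_R S\to X$, $p\otimes s\mapsto\phi(p)s$, and $S\otimes_R P\to X$, $s\otimes p\mapsto s\phi(p)$, are bijective. A morphism from $\phi:P\Rightarrow X$ to $\phi':P'\Rightarrow X'$ is a pair $(\alpha,\beta)$ of an $R$-bilinear map $\alpha:P\to P'$ and an $S$-bilinear map $\beta:X\to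 X'$ with $\beta\phi=\phi'\alpha$. Its isomorphism classes form a monoid under $(P\Rightarrow X)(Q\Rightarrow Y)=(P\otimes_R Q\Rightarrow X\otimes_S Y)$, via $p\otimes q\mapsto\phi(p)\otimes\psi(q)$, with neutral element the class of the inclusion $R\Rightarrow S$. $\mathcal{P}(S/R)$ is the submonoid of the classes of $P\Rightarrow X$ with $[P]\in\mathrm{Pic}(R)$ and $[X]\in\mathrm{Pic}(S)$. \end{itemize} Proposition. $\mathcal{P}(S/R)$ is a group, and there is an exact sequence of groups $$1\to \mathrm{Ker}(\mathcal{D})\cap\mathrm{Ker}\,\widehat{(-)}\to \mathrm{Ker}\,\widehat{(-)}\xrightarrow{\ \mathcal{D}_/\ }\mathrm{Inv}_R(S)\xrightarrow{\ \mathcal{D}'\ }\mathcal{P}(S/R)\xrightarrow{\ \mathcal{O}_r\ }\mathrm{Pic}(S),$$ where the first map is the inclusion, $\mathcal{D}_/$ is the restriction of $\mathcal{D}$, $\mathcal{D}'(X)$ is the class of the inclusion $X\Rightarrow S$, and $\mathcal{O}_r$ sends the class of $P\Rightarrow X$ to $[X]$. (Exactness is not claimed at $\mathrm{Pic}(S)$.)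 -/

import Mathlib

open scoped TensorProduct

universe u

namespace LocUnits

/-! ## Rings with local units -/

/-- `E` is a set of local units of the (associative, not necessarily unital) ring `A`:
a set of idempotents such that every finite subset of `A` has a two-sided unit in `E`. -/
class IsLocalUnits {A : Type u} [NonUnitalRing A] (E : Set A) : Prop where
  idem : ∀ e ∈ E, e * e = e
  exists_unit : ∀ F : Finset A, ∃ e ∈ E, ∀ a ∈ F, e * a = a ∧ a * e = a

/-- The set `Unit{a}` of those `e ∈ E` with `e a = a = a e`. -/
def unitSet {A : Type u} [NonUnitalRing A] (E : Set A) (a : A) : Set A :=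
  {e | e ∈ E ∧ e * a = a ∧ a * e = a}

theorem exists_unit_two {A : Type u} [NonUnitalRing A] (E : Set A) [IsLocalUnits E] (a b : A) :
    ∃ e ∈ E, (e * a = a ∧ a * e = a) ∧ (e * b = b ∧ b * e = b) := by
  classical
  obtain ⟨e, he, h⟩ := IsLocalUnits.exists_unit (E := E) {a, b}
  exact ⟨e, he, h a (by simp), h b (by simp)⟩

theorem exists_mem_unitSet {A : Type u} [NonUnitalRing A] (E : Set A) [IsLocalUnits E] (a : A) :
    ∃ e, e ∈ unitSet E a := by
  obtain ⟨e, he, h, -⟩ := exists_unit_two E a a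
  exact ⟨e, he, h⟩

section Extension

variable {S : Type u} [NonUnitalRing S] (R : NonUnitalSubring S) (E : Set R)

/-- A set `E` of elements of the subring `R` of `S`, viewed as a set of elements of `S`. -/
abbrev up : Set S := Subtype.val '' E

instance [h : IsLocalUnits (up R E)] : IsLocalUnits E where
  idem e he := Subtype.ext (h.idem e ⟨e, he, rfl⟩)
  exists_unit F := by
    classical
    obtain ⟨_, ⟨e, he, rfl⟩, h'⟩ := h.exists_unit (F.image Subtype.val)
    refine ⟨e, he, fun a ha => ?_⟩
    have := h' a (Finset.mem_image_of_mem _ ha)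
    exact ⟨Subtype.ext this.1, Subtype.ext this.2⟩

end Extension

/-! ## Unital bimodules -/

/-- A unital bimodule over a ring `A` with a set of local units `E`: an abelian group with
commuting biadditive left and right actions `lact a x = a x` and `ract a x = x a` of `A`, such that
every element `x` satisfies `e x = x` and `x e' = x` for some `e, e' ∈ E`. -/
structure UBimod (A : Type u) [NonUnitalRing A] (E : Set A) : Type (u + 1) where
  carrier : Type u
  [grp : AddCommGroup carrier]
  lact : A →+ carrier →+ carrier
  ract : A →+ carrier →+ carrier
  lact_mul : ∀ a b x, lact (a * b) x = lact a (lact b x)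
  ract_mul : ∀ a b x, ract (a * b) x = ract b (ract a x)
  act_comm : ∀ a b x, ract b (lact a x) = lact a (ract b x)
  left_unital : ∀ x, ∃ e ∈ E, lact e x = x
  right_unital : ∀ x, ∃ e ∈ E, ract e x = x

attribute [instance] UBimod.grp

instance (A : Type u) [NonUnitalRing A] (E : Set A) : CoeSort (UBimod A E) (Type u) :=
  ⟨UBimod.carrier⟩

namespace UBimod

section Basic

variable {A : Type u} [NonUnitalRing A] {E : Set A}

/-- An isomorphism of `A`-bimodules. -/
structure Iso (M N : UBimod A E) extends M ≃+ N where
  map_lact : ∀ a x, toFun (M.lact a x) = N.lact a (toFun x)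
  map_ract : ∀ a x, toFun (M.ract a x) = N.ract a (toFun x)

/-- An `A`-bilinear map, i.e. a homomorphism of `A`-bimodules. -/
structure Hom (M N : UBimod A E) extends M →+ N where
  map_lact : ∀ a x, toFun (M.lact a x) = N.lact a (toFun x)
  map_ract : ∀ a x, toFun (M.ract a x) = N.ract a (toFun x)

variable {M N K M' N' : UBimod A E}

theorem Iso.map_l (f : Iso M N) (a : A) (x : M) :
    f.toAddEquiv (M.lact a x) = N.lact a (f.toAddEquiv x) := f.map_lact a x

theorem Iso.map_r (f : Iso M N) (a : A) (x : M) :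
    f.toAddEquiv (M.ract a x) = N.ract a (f.toAddEquiv x) := f.map_ract a x

theorem Hom.map_l (f : Hom M N) (a : A) (x : M) :
    f.toAddMonoidHom (M.lact a x) = N.lact a (f.toAddMonoidHom x) := f.map_lact a x

theorem Hom.map_r (f : Hom M N) (a : A) (x : M) :
    f.toAddMonoidHom (M.ract a x) = N.ract a (f.toAddMonoidHom x) := f.map_ract a x

/-- The identity isomorphism. -/
def Iso.refl (M : UBimod A E) : Iso M M where
  toAddEquiv := AddEquiv.refl M
  map_lact _ _ := rfl
  map_ract _ _ := rfl

/-- The inverse isomorphism. -/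
def Iso.symm (f : Iso M N) : Iso N M where
  toAddEquiv := f.toAddEquiv.symm
  map_lact a x := by
    change f.toAddEquiv.symm _ = M.lact a (f.toAddEquiv.symm x)
    rw [AddEquiv.symm_apply_eq, f.map_l, AddEquiv.apply_symm_apply]
  map_ract a x := by
    change f.toAddEquiv.symm _ = M.ract a (f.toAddEquiv.symm x)
    rw [AddEquiv.symm_apply_eq, f.map_r, AddEquiv.apply_symm_apply]

/-- The composite of two isomorphisms. -/
def Iso.trans (f : Iso M N) (g : Iso N K) : Iso M K where
  toAddEquiv := f.toAddEquiv.trans g.toAddEquiv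
  map_lact a x := by
    change g.toAddEquiv (f.toAddEquiv _) = K.lact a (g.toAddEquiv (f.toAddEquiv x))
    rw [f.map_l, g.map_l]
  map_ract a x := by
    change g.toAddEquiv (f.toAddEquiv _) = K.ract a (g.toAddEquiv (f.toAddEquiv x))
    rw [f.map_r, g.map_r]

/-- A bijective bilinear map is an isomorphism. -/
noncomputable def Iso.ofBijective (f : M →+ N) (hf : Function.Bijective f)
    (hl : ∀ a x, f (M.lact a x) = N.lact a (f x)) (hr : ∀ a x, f (M.ract a x) = N.ract a (f x)) :
    Iso M N where
  toAddEquiv := AddEquiv.ofBijective f hf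
  map_lact := hl
  map_ract := hr

/-! ### The tensor product over `A` -/

/-- The subgroup of `M ⊗[ℤ] N` generated by the elements `m a ⊗ n - m ⊗ a n`. -/
def balanced (M N : UBimod A E) : AddSubgroup (M ⊗[ℤ] N) :=
  AddSubgroup.closure {t | ∃ (m : M) (a : A) (n : N), t = M.ract a m ⊗ₜ n - m ⊗ₜ N.lact a n}

/-- The abelian group underlying the tensor product of `M` and `N` over `A`. -/
def Ten (M N : UBimod A E) : Type u := (M ⊗[ℤ] N) ⧸ balanced M N

noncomputable instance (M N : UBimod A E) : AddCommGroup (Ten M N) :=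
  inferInstanceAs (AddCommGroup ((M ⊗[ℤ] N) ⧸ balanced M N))

namespace Ten

/-- The quotient map from the tensor product over `ℤ`. -/
noncomputable def proj (M N : UBimod A E) : M ⊗[ℤ] N →+ Ten M N := QuotientAddGroup.mk' (balanced M N)

/-- The pure tensor `m ⊗ n`, as a biadditive map. -/
noncomputable def mk (M N : UBimod A E) : M →+ N →+ Ten M N :=
  AddMonoidHom.mk' (fun m => AddMonoidHom.mk' (fun n => proj M N (m ⊗ₜ n))
    (fun x y => by rw [TensorProduct.tmul_add, map_add]))
    (fun x y => by
      ext n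
      change proj M N ((x + y) ⊗ₜ n) = proj M N (x ⊗ₜ n) + proj M N (y ⊗ₜ n)
      rw [TensorProduct.add_tmul, map_add])

theorem mk_bal (m : M) (a : A) (n : N) : mk M N (M.ract a m) n = mk M N m (N.lact a n) := by
  refine QuotientAddGroup.eq_iff_sub_mem.2 ?_
  exact AddSubgroup.subset_closure ⟨m, a, n, rfl⟩

/-- The homomorphism out of the tensor product given by a balanced biadditive map. -/
noncomputable def lift {G : Type u} [AddCommGroup G] (f : M →+ N →+ G)
    (hf : ∀ m a n, f (M.ract a m) n = f m (N.lact a n)) : Ten M N →+ G :=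
  QuotientAddGroup.lift (balanced M N)
    (TensorProduct.liftAddHom f (fun k m n => by simp)) (by
      unfold balanced
      rw [AddSubgroup.closure_le]
      rintro _ ⟨m, a, n, rfl⟩
      simp [hf])

@[simp] theorem lift_mk {G : Type u} [AddCommGroup G] (f : M →+ N →+ G)
    (hf : ∀ m a n, f (M.ract a m) n = f m (N.lact a n)) (m : M) (n : N) :
    lift f hf (mk M N m n) = f m n := rfl

theorem induction {p : Ten M N → Prop} (h0 : p 0) (hmk : ∀ m n, p (mk M N m n))
    (hadd : ∀ x y, p x → p y → p (x + y)) (z : Ten M N) : p z := by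
  induction z using QuotientAddGroup.induction_on with
  | H t =>
    induction t using TensorProduct.induction_on with
    | zero => exact h0
    | tmul m n => exact hmk m n
    | add x y hx hy => exact hadd _ _ hx hy

theorem hom_ext {G : Type u} [AddCommGroup G] {f g : Ten M N →+ G}
    (h : ∀ m n, f (mk M N m n) = g (mk M N m n)) : f = g := by
  ext z
  induction z using induction with
  | h0 => simp
  | hmk m n => exact h m n
  | hadd x y hx hy => rw [map_add, map_add, hx, hy]

/-- Functoriality of the tensor product. -/
noncomputable def map (f : M →+ M') (g : N →+ N') (hf : ∀ a x, f (M.ract a x) = M'.ract a (f x))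
    (hg : ∀ a x, g (N.lact a x) = N'.lact a (g x)) : Ten M N →+ Ten M' N' :=
  lift (((AddMonoidHom.compHom'  g).comp ((mk M' N'))).comp f) (fun m a n => by
    change mk M' N' (f _) (g _) = mk M' N' (f _) (g _)
    rw [hf, hg, mk_bal])

@[simp] theorem map_mk (f : M →+ M') (g : N →+ N')
    (hf : ∀ a x, f (M.ract a x) = M'.ract a (f x))
    (hg : ∀ a x, g (N.lact a x) = N'.lact a (g x)) (m : M) (n : N) :
    map f g hf hg (mk M N m n) = mk M' N' (f m) (g n) := rfl

end Ten

variable [IsLocalUnits E]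

/-- The tensor product of unital `A`-bimodules over `A`, with `a (m ⊗ n) b = (a m) ⊗ (n b)`. -/
noncomputable def tensor (M N : UBimod A E) : UBimod A E where
  carrier := Ten M N
  lact := AddMonoidHom.mk' (fun a => Ten.map (M.lact a) (AddMonoidHom.id N)
      (fun b x => (M.act_comm a b x).symm) (fun _ _ => rfl)) (fun a b => by
        apply Ten.hom_ext; intro m n; simp)
  ract := AddMonoidHom.mk' (fun a => Ten.map (AddMonoidHom.id M) (N.ract a)
      (fun _ _ => rfl) (fun b x => N.act_comm b a x)) (fun a b => by
        apply Ten.hom_ext; intro m n; simp)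
  lact_mul a b x := by
    induction x using Ten.induction with
    | h0 => simp
    | hmk m n => simp [M.lact_mul]
    | hadd x y hx hy => simp only [map_add, hx, hy]
  ract_mul a b x := by
    induction x using Ten.induction with
    | h0 => simp
    | hmk m n => simp [N.ract_mul]
    | hadd x y hx hy => simp only [map_add, hx, hy]
  act_comm a b x := by
    induction x using Ten.induction with
    | h0 => simp
    | hmk m n => simp
    | hadd x y hx hy => simp only [map_add, hx, hy]
  left_unital x := by
    induction x using Ten.induction with
    | h0 => obtain ⟨e, he, -⟩ := exists_unit_two E 0 0; exact ⟨e, he, by simp⟩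
    | hmk m n =>
      obtain ⟨e, he, h⟩ := M.left_unital m
      exact ⟨e, he, by simp [h]⟩
    | hadd x y hx hy =>
      obtain ⟨e, he, hx⟩ := hx
      obtain ⟨f, hf, hy⟩ := hy
      obtain ⟨g, hg, ⟨h1, -⟩, ⟨h2, -⟩⟩ := exists_unit_two E e f
      refine ⟨g, hg, ?_⟩
      have key : ∀ (a b : A) (z : Ten M N), Ten.map (M.lact (a * b)) (AddMonoidHom.id N)
          (fun b x => (M.act_comm _ b x).symm) (fun _ _ => rfl) z =
          Ten.map (M.lact a) (AddMonoidHom.id N)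
          (fun b x => (M.act_comm _ b x).symm) (fun _ _ => rfl) (Ten.map (M.lact b)
          (AddMonoidHom.id N) (fun b x => (M.act_comm _ b x).symm) (fun _ _ => rfl) z) := by
        intro a b z
        induction z using Ten.induction with
        | h0 => simp
        | hmk m n => simp [M.lact_mul]
        | hadd x y hx hy => simp only [map_add, hx, hy]
      simp only [AddMonoidHom.mk'_apply, map_add] at hx hy ⊢
      have k1 := key g e x
      have k2 := key g f y
      simp only [h1, h2, hx, hy] at k1 k2
      rw [← k1, ← k2]
  right_unital x := by
    induction x using Ten.induction with
    | h0 => obtain ⟨e, he, -⟩ := exists_unit_two E 0 0; exact ⟨e, he, by simp⟩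
    | hmk m n =>
      obtain ⟨e, he, h⟩ := N.right_unital n
      exact ⟨e, he, by simp [h]⟩
    | hadd x y hx hy =>
      obtain ⟨e, he, hx⟩ := hx
      obtain ⟨f, hf, hy⟩ := hy
      obtain ⟨g, hg, ⟨-, h1⟩, ⟨-, h2⟩⟩ := exists_unit_two E e f
      refine ⟨g, hg, ?_⟩
      have key : ∀ (a b : A) (z : Ten M N), Ten.map (AddMonoidHom.id M) (N.ract (a * b))
          (fun _ _ => rfl) (fun b x => N.act_comm b _ x) z =
          Ten.map (AddMonoidHom.id M) (N.ract b)
          (fun _ _ => rfl) (fun b x => N.act_comm b _ x) (Ten.map (AddMonoidHom.id M) (N.ract a)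
          (fun _ _ => rfl) (fun b x => N.act_comm b _ x) z) := by
        intro a b z
        induction z using Ten.induction with
        | h0 => simp
        | hmk m n => simp [N.ract_mul]
        | hadd x y hx hy => simp only [map_add, hx, hy]
      simp only [AddMonoidHom.mk'_apply, map_add] at hx hy ⊢
      have k1 := key e g x
      have k2 := key f g y
      simp only [h1, h2, hx, hy] at k1 k2
      rw [← k1, ← k2]

/-- The pure tensor `m ⊗ n`, as a biadditive map into the tensor product bimodule. -/
noncomputable def tmk (M N : UBimod A E) : M →+ N →+ tensor M N := Ten.mk M N

/-- The homomorphism out of the tensor product bimodule given by a balanced biadditive map. -/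
noncomputable def tlift {G : Type u} [AddCommGroup G] (f : M →+ N →+ G)
    (hf : ∀ m a n, f (M.ract a m) n = f m (N.lact a n)) : tensor M N →+ G := Ten.lift f hf

@[simp] theorem tlift_mk {G : Type u} [AddCommGroup G] (f : M →+ N →+ G)
    (hf : ∀ m a n, f (M.ract a m) n = f m (N.lact a n)) (m : M) (n : N) :
    tlift f hf (tmk M N m n) = f m n := rfl

@[simp] theorem lact_tmk (a : A) (m : M) (n : N) :
    (tensor M N).lact a (tmk M N m n) = tmk M N (M.lact a m) n := rfl

@[simp] theorem ract_tmk (a : A) (m : M) (n : N) :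
    (tensor M N).ract a (tmk M N m n) = tmk M N m (N.ract a n) := rfl

theorem tmk_bal (m : M) (a : A) (n : N) : tmk M N (M.ract a m) n = tmk M N m (N.lact a n) :=
  Ten.mk_bal m a n

theorem tinduction {p : tensor M N → Prop} (h0 : p 0) (hmk : ∀ m n, p (tmk M N m n))
    (hadd : ∀ x y, p x → p y → p (x + y)) (z : tensor M N) : p z :=
  Ten.induction h0 hmk hadd z

theorem thom_ext {G : Type u} [AddCommGroup G] {f g : tensor M N →+ G}
    (h : ∀ m n, f (tmk M N m n) = g (tmk M N m n)) : f = g := Ten.hom_ext h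

theorem thom_ext_apply {G : Type u} [AddCommGroup G] {f g : tensor M N →+ G}
    (h : ∀ m n, f (tmk M N m n) = g (tmk M N m n)) (z : tensor M N) : f z = g z :=
  DFunLike.congr_fun (thom_ext h) z

/-- Functoriality of the tensor product. -/
noncomputable def tmap (f : M →+ M') (g : N →+ N') (hf : ∀ a x, f (M.ract a x) = M'.ract a (f x))
    (hg : ∀ a x, g (N.lact a x) = N'.lact a (g x)) : tensor M N →+ tensor M' N' :=
  tlift (((AddMonoidHom.compHom' g).comp (tmk M' N')).comp f) (fun m a n => by
    change tmk M' N' (f _) (g _) = tmk M' N' (f _) (g _)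
    rw [hf, hg, tmk_bal])

@[simp] theorem tmap_mk (f : M →+ M') (g : N →+ N')
    (hf : ∀ a x, f (M.ract a x) = M'.ract a (f x))
    (hg : ∀ a x, g (N.lact a x) = N'.lact a (g x)) (m : M) (n : N) :
    tmap f g hf hg (tmk M N m n) = tmk M' N' (f m) (g n) := rfl

theorem tmap_bijective (f : M ≃+ M') (g : N ≃+ N')
    (hf : ∀ a x, f (M.ract a x) = M'.ract a (f x))
    (hg : ∀ a x, g (N.lact a x) = N'.lact a (g x)) :
    Function.Bijective (tmap f.toAddMonoidHom g.toAddMonoidHom hf hg) := by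
  have hf' : ∀ a x, f.symm (M'.ract a x) = M.ract a (f.symm x) := fun a x => by
    rw [AddEquiv.symm_apply_eq, hf, AddEquiv.apply_symm_apply]
  have hg' : ∀ a x, g.symm (N'.lact a x) = N.lact a (g.symm x) := fun a x => by
    rw [AddEquiv.symm_apply_eq, hg, AddEquiv.apply_symm_apply]
  refine Function.bijective_iff_has_inverse.2
    ⟨tmap f.symm.toAddMonoidHom g.symm.toAddMonoidHom hf' hg', fun z => ?_, fun z => ?_⟩
  · induction z using tinduction with
    | h0 => simp
    | hmk m n => simp
    | hadd x y hx hy => simp only [map_add, hx, hy]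
  · induction z using tinduction with
    | h0 => simp
    | hmk m n => simp
    | hadd x y hx hy => simp only [map_add, hx, hy]

/-- Functoriality of the tensor product on isomorphisms. -/
noncomputable def Iso.tensor (f : Iso M M') (g : Iso N N') :
    Iso (tensor M N) (tensor M' N') :=
  Iso.ofBijective _ (tmap_bijective f.toAddEquiv g.toAddEquiv f.map_r g.map_l)
    (fun a z => by
      induction z using tinduction with
      | h0 => simp
      | hmk m n => simp [f.map_l]
      | hadd x y hx hy => simp only [map_add, hx, hy])
    (fun a z => by
      induction z using tinduction with
      | h0 => simp
      | hmk m n => simp [g.map_r]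
      | hadd x y hx hy => simp only [map_add, hx, hy])

@[simp] theorem Iso.tensor_mk (f : Iso M M') (g : Iso N N') (m : M) (n : N) :
    (Iso.tensor f g).toAddEquiv (tmk M N m n) = tmk M' N' (f.toAddEquiv m) (g.toAddEquiv n) := rfl

/-- The map `(m ⊗ n) ⊗ k ↦ m ⊗ (n ⊗ k)`. -/
noncomputable def assocFwd (M N K : UBimod A E) :
    tensor (tensor M N) K →+ tensor M (tensor N K) :=
  tlift (tlift (AddMonoidHom.mk' (fun m => AddMonoidHom.mk' (fun n =>
      (tmk M (tensor N K) m).comp (tmk N K n)) (fun x y => by ext k; simp))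
      (fun x y => by ext n k; simp)) (fun m a n => by
        ext k
        change tmk M _ _ (tmk N K _ _) = tmk M _ _ (tmk N K _ _)
        rw [tmk_bal]; rfl)) (fun z a k => by
      induction z using tinduction with
      | h0 => simp
      | hmk m n =>
        change tmk M _ _ (tmk N K _ _) = tmk M _ _ (tmk N K _ _)
        rw [tmk_bal]
        rfl
      | hadd x y hx hy => simp only [map_add, AddMonoidHom.add_apply, hx, hy])

/-- The map `m ⊗ (n ⊗ k) ↦ (m ⊗ n) ⊗ k`. -/
noncomputable def assocBwd (M N K : UBimod A E) :
    tensor M (tensor N K) →+ tensor (tensor M N) K :=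
  tlift (AddMonoidHom.mk' (fun m => tlift (AddMonoidHom.mk' (fun n =>
      tmk (tensor M N) K (tmk M N m n)) (fun x y => by simp))
      (fun n a k => by
        change tmk _ K ((tensor M N).ract a (tmk M N m n)) k = tmk _ K (tmk M N m n) (K.lact a k)
        rw [tmk_bal])) (fun x y => by apply thom_ext; intro n k; simp))
      (fun m a z => by
      induction z using tinduction with
      | h0 => simp
      | hmk n k =>
        change tmk _ K (tmk M N _ _) _ = tmk _ K (tmk M N _ _) _
        rw [tmk_bal]
        rfl
      | hadd x y hx hy => simp only [map_add, hx, hy])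

@[simp] theorem assocFwd_mk (m : M) (n : N) (k : K) :
    assocFwd M N K (tmk _ K (tmk M N m n) k) = tmk M _ m (tmk N K n k) := rfl

@[simp] theorem assocBwd_mk (m : M) (n : N) (k : K) :
    assocBwd M N K (tmk M _ m (tmk N K n k)) = tmk _ K (tmk M N m n) k := rfl

theorem tinduction3 {p : tensor (tensor M N) K → Prop} (h0 : p 0)
    (hmk : ∀ m n k, p (tmk _ K (tmk M N m n) k))
    (hadd : ∀ x y, p x → p y → p (x + y)) (z : tensor (tensor M N) K) : p z := by
  induction z using tinduction with
  | h0 => exact h0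
  | hmk z k =>
    induction z using tinduction with
    | h0 => simpa using h0
    | hmk m n => exact hmk m n k
    | hadd x y hx hy => rw [map_add]; exact hadd _ _ hx hy
  | hadd x y hx hy => exact hadd _ _ hx hy

theorem thom_ext3_apply {G : Type u} [AddCommGroup G] {f g : tensor (tensor M N) K →+ G}
    (h : ∀ m n k, f (tmk _ K (tmk M N m n) k) = g (tmk _ K (tmk M N m n) k))
    (z : tensor (tensor M N) K) : f z = g z := by
  induction z using tinduction3 with
  | h0 => simp
  | hmk m n k => exact h m n k
  | hadd x y hx hy => rw [map_add, map_add, hx, hy]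

theorem assoc_bijective (M N K : UBimod A E) : Function.Bijective (assocFwd M N K) := by
  refine Function.bijective_iff_has_inverse.2 ⟨assocBwd M N K, fun z => ?_, fun z => ?_⟩
  · induction z using tinduction3 with
    | h0 => simp
    | hmk m n k => simp
    | hadd x y hx hy => simp only [map_add, hx, hy]
  · induction z using tinduction with
    | h0 => simp
    | hmk m z =>
      induction z using tinduction with
      | h0 => simp
      | hmk n k => simp
      | hadd x y hx hy => simp only [map_add, hx, hy]
    | hadd x y hx hy => simp only [map_add, hx, hy]

/-- Associativity of the tensor product. -/
noncomputable def assoc (M N K : UBimod A E) :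
    Iso (tensor (tensor M N) K) (tensor M (tensor N K)) :=
  Iso.ofBijective _ (assoc_bijective M N K)
    (fun a z => by
      induction z using tinduction3 with
      | h0 => simp
      | hmk m n k => simp
      | hadd x y hx hy => simp only [map_add, hx, hy])
    (fun a z => by
      induction z using tinduction3 with
      | h0 => simp
      | hmk m n k => simp
      | hadd x y hx hy => simp only [map_add, hx, hy])

@[simp] theorem assoc_mk (m : M) (n : N) (k : K) :
    (assoc M N K).toAddEquiv (tmk _ K (tmk M N m n) k) = tmk M _ m (tmk N K n k) := rfl

variable (A E) in
/-- The ring `A` as a unital bimodule over itself. -/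
abbrev regular : UBimod A E where
  carrier := A
  lact := AddMonoidHom.mul
  ract := AddMonoidHom.mul.flip
  lact_mul := mul_assoc
  ract_mul a b x := (mul_assoc x a b).symm
  act_comm a b x := mul_assoc a x b
  left_unital x := by
    obtain ⟨e, he, h, -⟩ := exists_mem_unitSet E x
    exact ⟨e, he, h⟩
  right_unital x := by
    obtain ⟨e, he, -, h⟩ := exists_mem_unitSet E x
    exact ⟨e, he, h⟩

theorem leftUnit_bijective (M : UBimod A E) : Function.Bijective
    (tlift (M := regular A E) (N := M) M.lact (fun b a m => M.lact_mul b a m)) := by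
  set f := tlift (M := regular A E) (N := M) M.lact (fun b a m => M.lact_mul b a m) with hf
  constructor
  · rw [injective_iff_map_eq_zero]
    intro z hz
    obtain ⟨e, he, h⟩ := (tensor (regular A E) M).left_unital z
    have key : ∀ z, (tensor (regular A E) M).lact e z = tmk (regular A E) M e (f z) := by
      intro z
      induction z using tinduction with
      | h0 => simp
      | hmk a m => exact tmk_bal (M := regular A E) (N := M) e a m
      | hadd x y hx hy => simp only [map_add, hx, hy]
    rw [← h, key, hz, map_zero]
  · intro m
    obtain ⟨e, he, h⟩ := M.left_unital m
    exact ⟨tmk (regular A E) M e m, h⟩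

theorem rightUnit_bijective (M : UBimod A E) : Function.Bijective
    (tlift (M := M) (N := regular A E) M.ract.flip (fun m a b => (M.ract_mul a b m).symm)) := by
  set f := tlift (M := M) (N := regular A E) M.ract.flip (fun m a b => (M.ract_mul a b m).symm)
    with hf
  constructor
  · rw [injective_iff_map_eq_zero]
    intro z hz
    obtain ⟨e, he, h⟩ := (tensor M (regular A E)).right_unital z
    let e' : regular A E := e
    have key : ∀ z, (tensor M (regular A E)).ract e z = tmk M (regular A E) (f z) e' := by
      intro z
      induction z using tinduction with
      | h0 => simp
      | hmk m a => exact (tmk_bal (M := M) (N := regular A E) m a e).symm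
      | hadd x y hx hy => simp only [map_add, AddMonoidHom.add_apply, hx, hy]
    rw [← h, key, hz, map_zero, AddMonoidHom.zero_apply]
  · intro m
    obtain ⟨e, he, h⟩ := M.right_unital m
    exact ⟨tmk M (regular A E) m e, h⟩

/-- The isomorphism `A ⊗ M ≅ M`. -/
noncomputable def leftUnit (M : UBimod A E) : Iso (tensor (regular A E) M) M :=
  Iso.ofBijective _ (leftUnit_bijective M)
    (fun a z => by
      induction z using tinduction with
      | h0 => simp
      | hmk b m => exact M.lact_mul a b m
      | hadd x y hx hy => simp only [map_add, hx, hy])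
    (fun a z => by
      induction z using tinduction with
      | h0 => simp
      | hmk b m => exact (M.act_comm b a m).symm
      | hadd x y hx hy => simp only [map_add, hx, hy])

/-- The isomorphism `M ⊗ A ≅ M`. -/
noncomputable def rightUnit (M : UBimod A E) : Iso (tensor M (regular A E)) M :=
  Iso.ofBijective _ (rightUnit_bijective M)
    (fun a z => by
      induction z using tinduction with
      | h0 => simp
      | hmk m b => exact M.act_comm a b m
      | hadd x y hx hy => simp only [map_add, hx, hy])
    (fun a z => by
      induction z using tinduction with
      | h0 => simp
      | hmk m b => exact M.ract_mul b a m
      | hadd x y hx hy => simp only [map_add, hx, hy])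

@[simp] theorem leftUnit_mk (a : A) (m : M) :
    (leftUnit M).toAddEquiv (tmk (regular A E) M a m) = M.lact a m := rfl

@[simp] theorem rightUnit_mk (a : A) (m : M) :
    (rightUnit M).toAddEquiv (tmk M (regular A E) m a) = M.ract a m := rfl

end Basic

/-! ### Isomorphism classes of bimodules and the Picard group -/

/-- Isomorphism of bimodules, as an equivalence relation. -/
instance setoid (A : Type u) [NonUnitalRing A] (E : Set A) : Setoid (UBimod A E) where
  r M N := Nonempty (Iso M N)
  iseqv := ⟨fun M => ⟨Iso.refl M⟩, fun ⟨f⟩ => ⟨f.symm⟩, fun ⟨f⟩ ⟨g⟩ => ⟨f.trans g⟩⟩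

end UBimod

/-- Isomorphism classes of unital `A`-bimodules. -/
def BimodClass (A : Type u) [NonUnitalRing A] (E : Set A) : Type (u + 1) :=
  Quotient (UBimod.setoid A E)

section Picard

variable (A : Type u) [NonUnitalRing A] (E : Set A)

/-- The isomorphism class `[M]`. -/
def BimodClass.of {A : Type u} [NonUnitalRing A] {E : Set A} (M : UBimod A E) : BimodClass A E :=
  Quotient.mk _ M

/-- The monoid of isomorphism classes of unital bimodules: `[M] [N] = [M ⊗ N]` and `1 = [A]`. -/
noncomputable instance [IsLocalUnits E] : Monoid (BimodClass A E) where
  mul := Quotient.map₂ UBimod.tensor (fun _ _ ⟨f⟩ _ _ ⟨g⟩ => ⟨f.tensor g⟩)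
  one := BimodClass.of (UBimod.regular A E)
  mul_assoc := by
    rintro ⟨M⟩ ⟨N⟩ ⟨K⟩
    exact Quotient.sound ⟨UBimod.assoc M N K⟩
  one_mul := by
    rintro ⟨M⟩
    exact Quotient.sound ⟨UBimod.leftUnit M⟩
  mul_one := by
    rintro ⟨M⟩
    exact Quotient.sound ⟨UBimod.rightUnit M⟩

/-- The Picard group of `A`: the isomorphism classes `[P]` of unital bimodules for which there is
a unital bimodule `Q` with bilinear isomorphisms `Q ⊗ P ≅ A ≅ P ⊗ Q`. -/
abbrev Pic [IsLocalUnits E] : Type (u + 1) := (BimodClass A E)ˣ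

end Picard

/-! ## The monoidal category `M(S/R)` and the group `P(S/R)` -/

section Extension

variable {S : Type u} [NonUnitalRing S] {R : NonUnitalSubring S} {E : Set R}

/-- The inclusion `R → S` as an additive map. -/
def incl (R : NonUnitalSubring S) : R →+ S := AddMonoidHom.mk' Subtype.val (fun _ _ => rfl)

@[simp] theorem incl_apply (r : R) : incl R r = (r : S) := rfl

/-- A unital `S`-bimodule regarded as a unital `R`-bimodule by restriction of scalars. -/
abbrev UBimod.res (X : UBimod S (up R E)) : UBimod R E where
  carrier := X.carrier
  lact := X.lact.comp (incl R)
  ract := X.ract.comp (incl R)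
  lact_mul a b x := X.lact_mul a b x
  ract_mul a b x := X.ract_mul a b x
  act_comm a b x := X.act_comm a b x
  left_unital x := by
    obtain ⟨_, ⟨e, he, rfl⟩, h⟩ := X.left_unital x
    exact ⟨e, he, h⟩
  right_unital x := by
    obtain ⟨_, ⟨e, he, rfl⟩, h⟩ := X.right_unital x
    exact ⟨e, he, h⟩

variable [IsLocalUnits (up R E)]

/-- `S` as an `R`-bimodule. -/
abbrev regS (R : NonUnitalSubring S) (E : Set R) [IsLocalUnits (up R E)] : UBimod R E :=
  (UBimod.regular S (up R E)).res

open UBimod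

section bar

variable {P : UBimod R E} {X : UBimod S (up R E)}

/-- For an `R`-bilinear map `φ : P → X`, the map `P ⊗_R S → X`, `p ⊗ s ↦ φ(p) s`. -/
noncomputable def barR (φ : Hom P X.res) : tensor P (regS R E) →+ X :=
  tlift (X.ract.flip.comp φ.toAddMonoidHom) (fun p a s => by
    change X.ract s (φ.toAddMonoidHom (P.ract a p)) = X.ract ((a : S) * s) (φ.toAddMonoidHom p)
    rw [φ.map_r, X.ract_mul]; rfl)

/-- For an `R`-bilinear map `φ : P → X`, the map `S ⊗_R P → X`, `s ⊗ p ↦ s φ(p)`. -/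
noncomputable def barL (φ : Hom P X.res) : tensor (regS R E) P →+ X :=
  tlift ((AddMonoidHom.compHom' φ.toAddMonoidHom).comp X.lact) (fun s a p => by
    change X.lact (s * (a : S)) (φ.toAddMonoidHom p) = X.lact s (φ.toAddMonoidHom (P.lact a p))
    rw [φ.map_l, X.lact_mul]; rfl)

theorem barR_mk (φ : Hom P X.res) (p : P) (s : S) :
    barR φ (tmk P (regS R E) p s) = X.ract s (φ.toAddMonoidHom p) := rfl

theorem barL_mk (φ : Hom P X.res) (s : S) (p : P) :
    barL φ (tmk (regS R E) P s p) = X.lact s (φ.toAddMonoidHom p) := rfl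

end bar

variable (R E) in
/-- An object `P ⇒ X` of the category `M(S/R)`: a unital `R`-bimodule `P`, a unital `S`-bimodule
`X` and an `R`-bilinear map `φ : P → X` such that the induced `(R,S)`-bilinear and
`(S,R)`-bilinear maps `P ⊗_R S → X` and `S ⊗_R P → X` are isomorphisms. -/
structure ExtObj : Type (u + 1) where
  P : UBimod R E
  X : UBimod S (up R E)
  φ : Hom P X.res
  bij_r : Function.Bijective (barR φ)
  bij_l : Function.Bijective (barL φ)

namespace ExtObj

/-- An isomorphism `(α, β)` in the category `M(S/R)`: a pair of bilinear isomorphisms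
with `β ∘ φ = φ' ∘ α`. -/
structure Iso (O O' : ExtObj R E) where
  α : UBimod.Iso O.P O'.P
  β : UBimod.Iso O.X O'.X
  comm : ∀ p, β.toAddEquiv (O.φ.toAddMonoidHom p) = O'.φ.toAddMonoidHom (α.toAddEquiv p)

/-- Isomorphism in `M(S/R)`, as an equivalence relation. -/
instance setoid (R : NonUnitalSubring S) (E : Set R) [IsLocalUnits (up R E)] :
    Setoid (ExtObj R E) where
  r O O' := Nonempty (Iso O O')
  iseqv := by
    refine ⟨fun O => ⟨⟨.refl _, .refl _, fun _ => rfl⟩⟩, ?_, ?_⟩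
    · rintro O O' ⟨f⟩
      refine ⟨⟨f.α.symm, f.β.symm, fun p => ?_⟩⟩
      change f.β.toAddEquiv.symm _ = O.φ.toAddMonoidHom (f.α.toAddEquiv.symm p)
      rw [AddEquiv.symm_apply_eq, f.comm, AddEquiv.apply_symm_apply]
    · rintro O O' O'' ⟨f⟩ ⟨g⟩
      refine ⟨⟨f.α.trans g.α, f.β.trans g.β, fun p => ?_⟩⟩
      change g.β.toAddEquiv (f.β.toAddEquiv _) = O''.φ.toAddMonoidHom (g.α.toAddEquiv (f.α.toAddEquiv p))
      rw [f.comm, g.comm]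

section mix

variable (O : ExtObj R E)

theorem exists_right_unit (p : O.P) : ∃ e : R, O.P.ract e p = p ∧
    O.X.ract (e : S) (O.φ.toAddMonoidHom p) = O.φ.toAddMonoidHom p := by
  obtain ⟨e, -, h⟩ := O.P.right_unital p
  refine ⟨e, h, ?_⟩
  have := O.φ.map_r e p
  rw [h] at this
  exact this.symm

theorem exists_left_unit (p : O.P) : ∃ e : R, O.P.lact e p = p ∧
    O.X.lact (e : S) (O.φ.toAddMonoidHom p) = O.φ.toAddMonoidHom p := by
  obtain ⟨e, -, h⟩ := O.P.left_unital p
  refine ⟨e, h, ?_⟩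
  have := O.φ.map_l e p
  rw [h] at this
  exact this.symm

/-- The map `P ⊗_R Y → X ⊗_S Y`, `p ⊗ y ↦ φ(p) ⊗ y`. -/
noncomputable def mixR (Y : UBimod S (up R E)) : tensor O.P Y.res →+ tensor O.X Y :=
  tlift ((tmk O.X Y).comp O.φ.toAddMonoidHom) (fun p a y => by
    change tmk O.X Y (O.φ.toAddMonoidHom (O.P.ract a p)) y =
      tmk O.X Y (O.φ.toAddMonoidHom p) (Y.lact (a : S) y)
    rw [O.φ.map_r, ← tmk_bal]; rfl)

theorem mixR_mk (Y : UBimod S (up R E)) (p : O.P) (y : Y) :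
    O.mixR Y (tmk O.P Y.res p y) = tmk O.X Y (O.φ.toAddMonoidHom p) y := rfl

theorem mixR_bijective (Y : UBimod S (up R E)) : Function.Bijective (O.mixR Y) := by
  let b : tensor O.P (regS R E) ≃+ O.X := AddEquiv.ofBijective _ O.bij_r
  let G : tensor O.P (regS R E) →+ (Y →+ tensor O.P Y.res) :=
    tlift (AddMonoidHom.mk' (fun p => AddMonoidHom.mk' (fun s : S =>
      (tmk O.P Y.res p).comp (Y.lact s)) (fun x y => by ext; simp))
      (fun x y => by ext; simp)) (fun p a s => by
        ext y
        change tmk O.P Y.res (O.P.ract a p) (Y.lact s y) = tmk O.P Y.res p (Y.lact ((a : S) * s) y)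
        rw [tmk_bal, Y.lact_mul]; rfl)
  have hG : ∀ (p : O.P) (s : S) (y : Y),
      G (tmk O.P (regS R E) p s) y = tmk O.P Y.res p (Y.lact s y) := fun _ _ _ => rfl
  have hb : ∀ (p : O.P) (s : S), b (tmk O.P (regS R E) p s) =
      O.X.ract s (O.φ.toAddMonoidHom p) := fun _ _ => rfl
  have hbal : ∀ (z : tensor O.P (regS R E)) (s : S) (y : Y),
      G (b.symm (O.X.ract s (b z))) y = G z (Y.lact s y) := by
    intro z s y
    induction z using tinduction with
    | h0 => simp
    | hmk p t =>
      have : O.X.ract s (b (tmk O.P (regS R E) p t)) = b (tmk O.P (regS R E) p (t * s : S)) := by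
        rw [hb]
        exact (O.X.ract_mul t s _).symm
      rw [this, AddEquiv.symm_apply_apply, hG, hG, Y.lact_mul]
    | hadd x y hx hy => simp only [map_add, AddMonoidHom.add_apply, hx, hy]
  let H : tensor O.X Y →+ tensor O.P Y.res :=
    tlift (G.comp b.symm.toAddMonoidHom) (fun x a y => by
      have := hbal (b.symm x) a y
      rw [AddEquiv.apply_symm_apply] at this
      exact this)
  have hH : ∀ (z : tensor O.P (regS R E)) (y : Y), H (tmk O.X Y (b z) y) = G z y := by
    intro z y
    change G (b.symm (b z)) y = G z y
    rw [AddEquiv.symm_apply_apply]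
  have hφ : ∀ p : O.P, ∃ e : R, O.P.ract e p = p ∧
      O.φ.toAddMonoidHom p = b (tmk O.P (regS R E) p (e : S)) := by
    intro p
    obtain ⟨e, h1, h2⟩ := O.exists_right_unit p
    exact ⟨e, h1, by rw [hb, h2]⟩
  refine Function.bijective_iff_has_inverse.2 ⟨H, fun z => ?_, fun z => ?_⟩
  · induction z using tinduction with
    | h0 => simp
    | hmk p y =>
      obtain ⟨e, h1, h2⟩ := hφ p
      rw [mixR_mk, h2, hH, hG]
      have := tmk_bal (M := O.P) (N := Y.res) p e y
      rw [h1] at this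
      exact this.symm
    | hadd x y hx hy => simp only [map_add, hx, hy]
  · induction z using tinduction with
    | h0 => simp
    | hmk x y =>
      obtain ⟨z, rfl⟩ := b.surjective x
      rw [hH]
      induction z using tinduction with
      | h0 => simp
      | hmk p s =>
        rw [hG, mixR_mk, hb, tmk_bal]
      | hadd z w hx hy => simp only [map_add, AddMonoidHom.add_apply, hx, hy]
    | hadd x y hx hy => simp only [map_add, hx, hy]

/-- The map `Y ⊗_R P → Y ⊗_S X`, `y ⊗ p ↦ y ⊗ φ(p)`. -/
noncomputable def mixL (Y : UBimod S (up R E)) : tensor Y.res O.P →+ tensor Y O.X :=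
  tlift ((AddMonoidHom.compHom' O.φ.toAddMonoidHom).comp (tmk Y O.X)) (fun y a p => by
    change tmk Y O.X (Y.ract (a : S) y) (O.φ.toAddMonoidHom p) =
      tmk Y O.X y (O.φ.toAddMonoidHom (O.P.lact a p))
    rw [O.φ.map_l, tmk_bal]; rfl)

theorem mixL_mk (Y : UBimod S (up R E)) (y : Y) (p : O.P) :
    O.mixL Y (tmk Y.res O.P y p) = tmk Y O.X y (O.φ.toAddMonoidHom p) := rfl

theorem mixL_bijective (Y : UBimod S (up R E)) : Function.Bijective (O.mixL Y) := by
  let b : tensor (regS R E) O.P ≃+ O.X := AddEquiv.ofBijective _ O.bij_l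
  let G : tensor (regS R E) O.P →+ (Y →+ tensor Y.res O.P) :=
    tlift (AddMonoidHom.mk' (fun s : S => AddMonoidHom.mk' (fun p =>
      ((tmk Y.res O.P).flip p).comp (Y.ract s)) (fun x y => by ext; simp))
      (fun x y => by ext; simp)) (fun s a p => by
        ext y
        change tmk Y.res O.P (Y.ract (s * (a : S)) y) p = tmk Y.res O.P (Y.ract s y) (O.P.lact a p)
        rw [← tmk_bal, Y.ract_mul]; rfl)
  have hG : ∀ (s : S) (p : O.P) (y : Y),
      G (tmk (regS R E) O.P s p) y = tmk Y.res O.P (Y.ract s y) p := fun _ _ _ => rfl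
  have hb : ∀ (s : S) (p : O.P), b (tmk (regS R E) O.P s p) =
      O.X.lact s (O.φ.toAddMonoidHom p) := fun _ _ => rfl
  have hbal : ∀ (z : tensor (regS R E) O.P) (s : S) (y : Y),
      G (b.symm (O.X.lact s (b z))) y = G z (Y.ract s y) := by
    intro z s y
    induction z using tinduction with
    | h0 => simp
    | hmk t p =>
      have : O.X.lact s (b (tmk (regS R E) O.P t p)) = b (tmk (regS R E) O.P (s * t : S) p) := by
        rw [hb]
        exact (O.X.lact_mul s t _).symm
      rw [this, AddEquiv.symm_apply_apply, hG, hG, Y.ract_mul]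
    | hadd x y hx hy => simp only [map_add, AddMonoidHom.add_apply, hx, hy]
  let H : tensor Y O.X →+ tensor Y.res O.P :=
    tlift (G.comp b.symm.toAddMonoidHom).flip (fun y a x => by
      have := hbal (b.symm x) a y
      rw [AddEquiv.apply_symm_apply] at this
      exact this.symm)
  have hH : ∀ (z : tensor (regS R E) O.P) (y : Y), H (tmk Y O.X y (b z)) = G z y := by
    intro z y
    change G (b.symm (b z)) y = G z y
    rw [AddEquiv.symm_apply_apply]
  have hφ : ∀ p : O.P, ∃ e : R, O.P.lact e p = p ∧
      O.φ.toAddMonoidHom p = b (tmk (regS R E) O.P (e : S) p) := by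
    intro p
    obtain ⟨e, h1, h2⟩ := O.exists_left_unit p
    exact ⟨e, h1, by rw [hb, h2]⟩
  refine Function.bijective_iff_has_inverse.2 ⟨H, fun z => ?_, fun z => ?_⟩
  · induction z using tinduction with
    | h0 => simp
    | hmk y p =>
      obtain ⟨e, h1, h2⟩ := hφ p
      rw [mixL_mk, h2, hH, hG]
      have := tmk_bal (M := Y.res) (N := O.P) y e p
      rw [h1] at this
      exact this
    | hadd x y hx hy => simp only [map_add, hx, hy]
  · induction z using tinduction with
    | h0 => simp
    | hmk y x =>
      obtain ⟨z, rfl⟩ := b.surjective x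
      rw [hH]
      induction z using tinduction with
      | h0 => simp
      | hmk s p =>
        rw [hG, mixL_mk, hb, tmk_bal]
      | hadd z w hx hy => simp only [map_add, AddMonoidHom.add_apply, hx, hy]
    | hadd x y hx hy => simp only [map_add, hx, hy]

end mix

/-- The map `P ⊗_R Q → X ⊗_S Y`, `p ⊗ q ↦ φ(p) ⊗ ψ(q)`. -/
noncomputable def chiHom (O O' : ExtObj R E) : tensor O.P O'.P →+ tensor O.X O'.X :=
  tlift (((AddMonoidHom.compHom' O'.φ.toAddMonoidHom).comp (tmk O.X O'.X)).comp
    O.φ.toAddMonoidHom) (fun p a q => by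
      change tmk O.X O'.X (O.φ.toAddMonoidHom (O.P.ract a p)) (O'.φ.toAddMonoidHom q) =
        tmk O.X O'.X (O.φ.toAddMonoidHom p) (O'.φ.toAddMonoidHom (O'.P.lact a q))
      rw [O.φ.map_r, O'.φ.map_l]
      exact tmk_bal _ (a : S) _)

/-- The map `P ⊗_R Q → X ⊗_S Y`, `p ⊗ q ↦ φ(p) ⊗ ψ(q)`, as an `R`-bilinear map. -/
noncomputable def chi (O O' : ExtObj R E) : Hom (tensor O.P O'.P) (tensor O.X O'.X).res where
  toAddMonoidHom := chiHom O O'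
  map_lact a z := thom_ext_apply (f := (chiHom O O').comp ((tensor O.P O'.P).lact a))
    (g := ((tensor O.X O'.X).lact (a : S)).comp (chiHom O O'))
    (fun p q => congrArg (fun x => tmk O.X O'.X x (O'.φ.toAddMonoidHom q)) (O.φ.map_l a p)) z
  map_ract a z := thom_ext_apply (f := (chiHom O O').comp ((tensor O.P O'.P).ract a))
    (g := ((tensor O.X O'.X).ract (a : S)).comp (chiHom O O'))
    (fun p q => congrArg (fun x => tmk O.X O'.X (O.φ.toAddMonoidHom p) x) (O'.φ.map_r a q)) z

@[simp] theorem chi_mk (O O' : ExtObj R E) (p : O.P) (q : O'.P) :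
    (chi O O').toAddMonoidHom (tmk O.P O'.P p q) =
      tmk O.X O'.X (O.φ.toAddMonoidHom p) (O'.φ.toAddMonoidHom q) := rfl

theorem chi_bij_r (O O' : ExtObj R E) : Function.Bijective (barR (chi O O')) := by
  let b : tensor O'.P (regS R E) ≃+ O'.X.res := AddEquiv.ofBijective (barR O'.φ) O'.bij_r
  have hb : ∀ (a : R) x, b ((tensor O'.P (regS R E)).lact a x) = O'.X.res.lact a (b x) := by
    intro a z
    induction z using tinduction with
    | h0 => simp
    | hmk q s =>
      change O'.X.ract s (O'.φ.toAddMonoidHom (O'.P.lact a q)) =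
        O'.X.lact (a : S) (O'.X.ract s (O'.φ.toAddMonoidHom q))
      rw [O'.φ.map_l, ← O'.X.act_comm]; rfl
    | hadd x y hx hy => simp only [map_add, hx, hy]
  have h1 := tmap_bijective (AddEquiv.refl O.P) b (fun a x => rfl) hb
  have h2 := ((O.mixR_bijective O'.X).comp h1).comp (assoc_bijective O.P O'.P (regS R E))
  convert h2 using 1
  funext z
  induction z using tinduction3 with
  | h0 => simp
  | hmk p q s => rfl
  | hadd x y hx hy => simp only [map_add, hx, hy, Function.comp_apply]

theorem chi_bij_l (O O' : ExtObj R E) : Function.Bijective (barL (chi O O')) := by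
  let b : tensor (regS R E) O.P ≃+ O.X.res := AddEquiv.ofBijective (barL O.φ) O.bij_l
  have hb : ∀ (a : R) x, b ((tensor (regS R E) O.P).ract a x) = O.X.res.ract a (b x) := by
    intro a z
    induction z using tinduction with
    | h0 => simp
    | hmk s p =>
      change O.X.lact s (O.φ.toAddMonoidHom (O.P.ract a p)) =
        O.X.ract (a : S) (O.X.lact s (O.φ.toAddMonoidHom p))
      rw [O.φ.map_r, O.X.act_comm]; rfl
    | hadd x y hx hy => simp only [map_add, hx, hy]
  have h1 := tmap_bijective b (AddEquiv.refl O'.P) hb (fun a x => rfl)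
  have h2 := (O'.mixL_bijective O.X).comp h1
  rw [← Function.Bijective.of_comp_iff _ (assoc_bijective (regS R E) O.P O'.P)]
  convert h2 using 1
  funext z
  exact thom_ext3_apply (f := (barL (chi O O')).comp (assocFwd (regS R E) O.P O'.P))
    (g := (O'.mixL O.X).comp (tmap b.toAddMonoidHom (AddEquiv.refl O'.P).toAddMonoidHom hb
      (fun _ _ => rfl))) (fun _ _ _ => rfl) z

/-- The tensor product in `M(S/R)`. -/
noncomputable def mul (O O' : ExtObj R E) : ExtObj R E where
  P := tensor O.P O'.P
  X := tensor O.X O'.X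
  φ := chi O O'
  bij_r := chi_bij_r O O'
  bij_l := chi_bij_l O O'

variable (R E) in
/-- The unit object `R ⊆ S` of `M(S/R)`. -/
noncomputable def one : ExtObj R E where
  P := regular R E
  X := regular S (up R E)
  φ := { toAddMonoidHom := incl R, map_lact := fun _ _ => rfl, map_ract := fun _ _ => rfl }
  bij_r := leftUnit_bijective (regS R E)
  bij_l := rightUnit_bijective (regS R E)

end ExtObj

variable (R E) in
/-- The monoid `S(S/R)` of isomorphism classes of objects of `M(S/R)`. -/
def ExtClass : Type (u + 1) := Quotient (ExtObj.setoid R E)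

namespace ExtClass

/-- The isomorphism class of an object of `M(S/R)`. -/
def of (O : ExtObj R E) : ExtClass R E := Quotient.mk _ O

theorem _root_.LocUnits.ExtObj.mul_congr {O O₁ O' O'₁ : ExtObj R E} (f : ExtObj.Iso O O₁)
    (g : ExtObj.Iso O' O'₁) : Nonempty (ExtObj.Iso (O.mul O') (O₁.mul O'₁)) :=
  ⟨⟨f.α.tensor g.α, f.β.tensor g.β, thom_ext_apply
    (f := (f.β.tensor g.β).toAddEquiv.toAddMonoidHom.comp (ExtObj.chiHom O O'))
    (g := (ExtObj.chiHom O₁ O'₁).comp (f.α.tensor g.α).toAddEquiv.toAddMonoidHom)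
    (fun p q => by
      change tmk O₁.X O'₁.X (f.β.toAddEquiv _) (g.β.toAddEquiv _) = tmk O₁.X O'₁.X
        (O₁.φ.toAddMonoidHom (f.α.toAddEquiv p)) (O'₁.φ.toAddMonoidHom (g.α.toAddEquiv q))
      rw [f.comm, g.comm])⟩⟩

/-- The product of `S(S/R)`, induced by the tensor product of `M(S/R)`; the neutral element is the
class of `R ⊆ S`. -/
noncomputable instance : Monoid (ExtClass R E) where
  mul := Quotient.map₂ ExtObj.mul (fun _ _ ⟨f⟩ _ _ ⟨g⟩ => ExtObj.mul_congr f g)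
  one := of (ExtObj.one R E)
  mul_assoc := by
    rintro ⟨O⟩ ⟨O'⟩ ⟨O''⟩
    exact Quotient.sound ⟨⟨UBimod.assoc _ _ _, UBimod.assoc _ _ _, thom_ext3_apply
      (f := (UBimod.assoc O.X O'.X O''.X).toAddEquiv.toAddMonoidHom.comp
        (ExtObj.chiHom (O.mul O') O''))
      (g := (ExtObj.chiHom O (O'.mul O'')).comp
        (UBimod.assoc O.P O'.P O''.P).toAddEquiv.toAddMonoidHom)
      (fun _ _ _ => rfl)⟩⟩
  one_mul := by
    rintro ⟨O⟩
    exact Quotient.sound ⟨⟨UBimod.leftUnit _, UBimod.leftUnit _, thom_ext_apply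
      (f := (UBimod.leftUnit O.X).toAddEquiv.toAddMonoidHom.comp
        (ExtObj.chiHom (ExtObj.one R E) O))
      (g := O.φ.toAddMonoidHom.comp (UBimod.leftUnit O.P).toAddEquiv.toAddMonoidHom)
      (fun a p => (O.φ.map_l a p).symm)⟩⟩
  mul_one := by
    rintro ⟨O⟩
    exact Quotient.sound ⟨⟨UBimod.rightUnit _, UBimod.rightUnit _, thom_ext_apply
      (f := (UBimod.rightUnit O.X).toAddEquiv.toAddMonoidHom.comp
        (ExtObj.chiHom O (ExtObj.one R E)))
      (g := O.φ.toAddMonoidHom.comp (UBimod.rightUnit O.P).toAddEquiv.toAddMonoidHom)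
      (fun p a => (O.φ.map_r a p).symm)⟩⟩

variable (R E) in
/-- The homomorphism `(P ⇒ X) ↦ [P]`. -/
def classP : ExtClass R E →* BimodClass R E where
  toFun := Quotient.lift (fun O => BimodClass.of O.P) (fun _ _ ⟨f⟩ => Quotient.sound ⟨f.α⟩)
  map_one' := rfl
  map_mul' := by rintro ⟨O⟩ ⟨O'⟩; rfl

variable (R E) in
/-- The homomorphism `(P ⇒ X) ↦ [X]`. -/
def classX : ExtClass R E →* BimodClass S (up R E) where
  toFun := Quotient.lift (fun O => BimodClass.of O.X) (fun _ _ ⟨f⟩ => Quotient.sound ⟨f.β⟩)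
  map_one' := rfl
  map_mul' := by rintro ⟨O⟩ ⟨O'⟩; rfl

end ExtClass

variable (R E) in
/-- `P(S/R)`: the submonoid of `S(S/R)` of the classes `[P] ⇒ [X]` with `[P] ∈ Pic(R)` and
`[X] ∈ Pic(S)`. -/
noncomputable def PSR : Submonoid (ExtClass R E) :=
  (IsUnit.submonoid (BimodClass R E)).comap (ExtClass.classP R E) ⊓
    (IsUnit.submonoid (BimodClass S (up R E))).comap (ExtClass.classX R E)

variable (R E) in
/-- The map `P(S/R) → Pic(S)`, `(P ⇒ X) ↦ [X]`. -/
noncomputable def Or : PSR R E →* Pic S (up R E) :=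
  IsUnit.liftRight ((ExtClass.classX R E).comp (PSR R E).subtype) (fun c => c.2.2)

/-! ## The group of invertible `R`-subbimodules of `S` -/

variable (R E) in
/-- A unital `R`-subbimodule of `S`. (Unitality is automatic here, because `E` is also
a set of local units of `S`; see `SubBimod.ofAddSubgroup`.) -/
@[ext] structure SubBimod where
  carrier : AddSubgroup S
  smul_mem : ∀ r ∈ R, ∀ x ∈ carrier, r * x ∈ carrier
  mem_smul : ∀ r ∈ R, ∀ x ∈ carrier, x * r ∈ carrier
  left_unital : ∀ x ∈ carrier, ∃ e ∈ E, (e : S) * x = x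
  right_unital : ∀ x ∈ carrier, ∃ e ∈ E, x * (e : S) = x

theorem exists_unit_in (E : Set R) [IsLocalUnits (up R E)] (s : S) :
    ∃ e ∈ E, (e : S) * s = s ∧ s * (e : S) = s := by
  obtain ⟨_, ⟨e, he, rfl⟩, h⟩ := exists_mem_unitSet (up R E) s
  exact ⟨e, he, h⟩

namespace SubBimod

/-- An additive subgroup of `S` closed under multiplication by `R` is a unital subbimodule. -/
def ofAddSubgroup (V : AddSubgroup S) (hl : ∀ r ∈ R, ∀ x ∈ V, r * x ∈ V)
    (hr : ∀ r ∈ R, ∀ x ∈ V, x * r ∈ V) : SubBimod R E where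
  carrier := V
  smul_mem := hl
  mem_smul := hr
  left_unital x _ := by
    obtain ⟨e, he, h⟩ := exists_unit_in E x
    exact ⟨e, he, h.1⟩
  right_unital x _ := by
    obtain ⟨e, he, h⟩ := exists_unit_in E x
    exact ⟨e, he, h.2⟩

/-- The product `V W`: all finite sums of elements `v w` with `v ∈ V`, `w ∈ W`. -/
def prod (V W : AddSubgroup S) : AddSubgroup S :=
  AddSubgroup.closure {s | ∃ v ∈ V, ∃ w ∈ W, s = v * w}

theorem mul_mem_prod {V W : AddSubgroup S} {v w : S} (hv : v ∈ V) (hw : w ∈ W) :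
    v * w ∈ prod V W := AddSubgroup.subset_closure ⟨v, hv, w, hw, rfl⟩

theorem prod_induction {V W : AddSubgroup S} {p : S → Prop} (h0 : p 0)
    (hm : ∀ v ∈ V, ∀ w ∈ W, p (v * w)) (ha : ∀ x y, p x → p y → p (x + y)) {s : S}
    (hs : s ∈ prod V W) : p s := by
  have : s ∈ prod V W ∧ p s := by
    unfold prod at hs
    induction hs using AddSubgroup.closure_induction'' with
    | mem x hx =>
      obtain ⟨v, hv, w, hw, rfl⟩ := hx
      exact ⟨mul_mem_prod hv hw, hm v hv w hw⟩
    | neg_mem x hx =>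
      obtain ⟨v, hv, w, hw, rfl⟩ := hx
      rw [← neg_mul]
      exact ⟨mul_mem_prod (V.neg_mem hv) hw, hm _ (V.neg_mem hv) w hw⟩
    | zero => exact ⟨zero_mem _, h0⟩
    | add x y _ _ hx hy => exact ⟨add_mem hx.1 hy.1, ha x y hx.2 hy.2⟩
  exact this.2

theorem prod_le {V W U : AddSubgroup S} (h : ∀ v ∈ V, ∀ w ∈ W, v * w ∈ U) : prod V W ≤ U :=
  fun _ hs => prod_induction (zero_mem _) h (fun _ _ => add_mem) hs

theorem prod_assoc (V W U : AddSubgroup S) : prod (prod V W) U = prod V (prod W U) := by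
  apply le_antisymm
  · refine prod_le fun s hs u hu => ?_
    refine prod_induction (p := fun s => s * u ∈ prod V (prod W U)) ?_ ?_ ?_ hs
    · simp
    · intro v hv w hw
      rw [mul_assoc]
      exact mul_mem_prod hv (mul_mem_prod hw hu)
    · intro x y hx hy
      rw [add_mul]
      exact add_mem hx hy
  · refine prod_le fun v hv s hs => ?_
    refine prod_induction (p := fun s => v * s ∈ prod (prod V W) U) ?_ ?_ ?_ hs
    · simp
    · intro w hw u hu
      rw [← mul_assoc]
      exact mul_mem_prod (mul_mem_prod hv hw) hu
    · intro x y hx hy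
      rw [mul_add]
      exact add_mem hx hy

/-- The monoid of unital `R`-subbimodules of `S`, with neutral element `R`. -/
instance : Monoid (SubBimod R E) where
  mul V W := ofAddSubgroup (prod V.carrier W.carrier)
    (fun r hr s hs => by
      refine prod_induction (p := fun s => r * s ∈ prod V.carrier W.carrier) ?_ ?_ ?_ hs
      · simp
      · intro v hv w hw
        rw [← mul_assoc]
        exact mul_mem_prod (V.smul_mem r hr v hv) hw
      · intro x y hx hy
        rw [mul_add]
        exact add_mem hx hy)
    (fun r hr s hs => by
      refine prod_induction (p := fun s => s * r ∈ prod V.carrier W.carrier) ?_ ?_ ?_ hs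
      · simp
      · intro v hv w hw
        rw [mul_assoc]
        exact mul_mem_prod hv (W.mem_smul r hr w hw)
      · intro x y hx hy
        rw [add_mul]
        exact add_mem hx hy)
  one := ofAddSubgroup R.toAddSubgroup (fun _ hr _ hx => R.mul_mem hr hx)
    (fun _ hr _ hx => R.mul_mem hx hr)
  mul_assoc V W U := SubBimod.ext (prod_assoc _ _ _)
  one_mul V := SubBimod.ext (le_antisymm (prod_le fun r hr v hv => V.smul_mem r hr v hv)
    (fun v hv => by
      obtain ⟨e, -, h⟩ := V.left_unital v hv
      rw [← h]
      exact mul_mem_prod e.2 hv))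
  mul_one V := SubBimod.ext (le_antisymm (prod_le fun v hv r hr => V.mem_smul r hr v hv)
    (fun v hv => by
      obtain ⟨e, -, h⟩ := V.right_unital v hv
      rw [← h]
      exact mul_mem_prod hv e.2))

theorem mul_carrier (V W : SubBimod R E) : (V * W).carrier = prod V.carrier W.carrier := rfl

theorem one_carrier : (1 : SubBimod R E).carrier = R.toAddSubgroup := rfl

/-- A subbimodule of `S` as a bimodule. -/
abbrev toUBimod (V : SubBimod R E) : UBimod R E where
  carrier := V.carrier
  lact := AddMonoidHom.mk' (fun r => AddMonoidHom.mk'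
    (fun x => (⟨r * x, V.smul_mem r r.2 x x.2⟩ : V.carrier))
    (fun x y => Subtype.ext (mul_add _ _ _)))
    (fun r s => by ext x; exact add_mul (r : S) s x)
  ract := AddMonoidHom.mk' (fun r => AddMonoidHom.mk'
    (fun x => (⟨x * r, V.mem_smul r r.2 x x.2⟩ : V.carrier))
    (fun x y => Subtype.ext (add_mul _ _ _)))
    (fun r s => by ext x; exact mul_add (x : S) r s)
  lact_mul a b x := Subtype.ext (mul_assoc (a : S) b x)
  ract_mul a b x := Subtype.ext (mul_assoc (x : S) a b).symm
  act_comm a b x := Subtype.ext (mul_assoc (a : S) x b)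
  left_unital x := by
    obtain ⟨e, he, h⟩ := V.left_unital x x.2
    exact ⟨e, he, Subtype.ext h⟩
  right_unital x := by
    obtain ⟨e, he, h⟩ := V.right_unital x x.2
    exact ⟨e, he, Subtype.ext h⟩

/-- The inclusion `V ⊆ S` as an `R`-bilinear map. -/
def inclHom (V : SubBimod R E) : Hom V.toUBimod (regS R E) where
  toAddMonoidHom := V.carrier.subtype
  map_lact _ _ := rfl
  map_ract _ _ := rfl

end SubBimod

variable (R E) in
/-- `Inv_R(S)`: the group of invertible unital `R`-subbimodules of `S`, i.e. of those `X` for which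
there is `Y` with `X Y = Y X = R`. -/
abbrev Inv : Type u := (SubBimod R E)ˣ

namespace Inv

variable (X : Inv R E)

theorem prod_inv : SubBimod.prod X.val.carrier X.inv.carrier = R.toAddSubgroup := by
  rw [← SubBimod.mul_carrier, X.val_inv, SubBimod.one_carrier]

theorem inv_prod : SubBimod.prod X.inv.carrier X.val.carrier = R.toAddSubgroup := by
  rw [← SubBimod.mul_carrier, X.inv_val, SubBimod.one_carrier]

theorem mul_inv_mem {x y : S} (hx : x ∈ X.val.carrier) (hy : y ∈ X.inv.carrier) : x * y ∈ R := by
  have := SubBimod.mul_mem_prod hx hy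
  rwa [prod_inv] at this

theorem inv_mul_mem {x y : S} (hy : y ∈ X.inv.carrier) (hx : x ∈ X.val.carrier) : y * x ∈ R := by
  have := SubBimod.mul_mem_prod hy hx
  rwa [inv_prod] at this

theorem injective_left (N : UBimod R E) (j : N →+ S) (hj : Function.Injective j)
    (hjl : ∀ (r : R) n, j (N.lact r n) = r * j n) (m : tensor X.val.toUBimod N →+ S)
    (hm : ∀ (x : X.val.carrier) (n : N), m (tmk X.val.toUBimod N x n) = (x : S) * j n) :
    Function.Injective m := by
  rw [injective_iff_map_eq_zero]
  intro z hz
  have key : ∀ w ∈ SubBimod.prod X.val.carrier X.inv.carrier,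
      ∃ hw : w ∈ R, (tensor X.val.toUBimod N).lact ⟨w, hw⟩ z = 0 := by
    intro w hw
    refine SubBimod.prod_induction (p := fun w => ∃ hw : w ∈ R,
      (tensor X.val.toUBimod N).lact ⟨w, hw⟩ z = 0) ?_ ?_ ?_ hw
    · refine ⟨zero_mem R, ?_⟩
      have : (⟨0, zero_mem R⟩ : R) = 0 := rfl
      rw [this, map_zero, AddMonoidHom.zero_apply]
    · intro x hx y hy
      refine ⟨X.mul_inv_mem hx hy, ?_⟩
      let k : tensor X.val.toUBimod N →+ N := tlift (AddMonoidHom.mk' (fun a : X.val.carrier =>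
        N.lact ⟨y * a, X.inv_mul_mem hy a.2⟩) (fun a b => by
          rw [← map_add]
          exact congrArg N.lact (Subtype.ext (mul_add y (a : S) b)))) (fun a r n => by
          change N.lact ⟨y * ((a : S) * r), _⟩ n = N.lact ⟨y * a, _⟩ (N.lact r n)
          rw [← N.lact_mul]
          exact congrArg (fun t => N.lact t n) (Subtype.ext (mul_assoc y (a : S) r).symm))
      have h1 : j (k z) = y * m z := thom_ext_apply (f := j.comp k)
        (g := (AddMonoidHom.mulLeft y).comp m) (fun (a : X.val.carrier) n => by
          change j (N.lact ⟨y * a, _⟩ n) = y * m _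
          rw [hjl, hm, ← mul_assoc]) z
      have h2 : (tensor X.val.toUBimod N).lact ⟨x * y, X.mul_inv_mem hx hy⟩ z =
          tmk X.val.toUBimod N (⟨x, hx⟩ : X.val.carrier) (k z) := thom_ext_apply
        (g := (tmk X.val.toUBimod N (⟨x, hx⟩ : X.val.carrier)).comp k)
        (fun (a : X.val.carrier) n => by
          change tmk X.val.toUBimod N (⟨(x * y) * a, _⟩ : X.val.carrier) n =
            tmk X.val.toUBimod N (⟨x, hx⟩ : X.val.carrier) (N.lact ⟨y * a, _⟩ n)
          rw [← tmk_bal]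
          exact congrArg (fun t : X.val.carrier => tmk X.val.toUBimod N t n)
            (Subtype.ext (mul_assoc x y (a : S)))) z
      have h3 : k z = 0 := hj (by rw [h1, hz, mul_zero, map_zero])
      rw [h2, h3, map_zero]
    · rintro v w ⟨hv, hv'⟩ ⟨hw, hw'⟩
      refine ⟨add_mem hv hw, ?_⟩
      have : (⟨v + w, add_mem hv hw⟩ : R) = ⟨v, hv⟩ + ⟨w, hw⟩ := rfl
      rw [this, map_add, AddMonoidHom.add_apply, hv', hw', add_zero]
  obtain ⟨e, -, h⟩ := (tensor X.val.toUBimod N).left_unital z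
  obtain ⟨h1, h2⟩ := key e (by rw [prod_inv]; exact e.2)
  rw [← h]
  exact h2

theorem injective_right (N : UBimod R E) (j : N →+ S) (hj : Function.Injective j)
    (hjr : ∀ (r : R) n, j (N.ract r n) = j n * r) (m : tensor N X.val.toUBimod →+ S)
    (hm : ∀ (n : N) (x : X.val.carrier), m (tmk N X.val.toUBimod n x) = j n * (x : S)) :
    Function.Injective m := by
  rw [injective_iff_map_eq_zero]
  intro z hz
  have key : ∀ w ∈ SubBimod.prod X.inv.carrier X.val.carrier,
      ∃ hw : w ∈ R, (tensor N X.val.toUBimod).ract ⟨w, hw⟩ z = 0 := by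
    intro w hw
    refine SubBimod.prod_induction (p := fun w => ∃ hw : w ∈ R,
      (tensor N X.val.toUBimod).ract ⟨w, hw⟩ z = 0) ?_ ?_ ?_ hw
    · refine ⟨zero_mem R, ?_⟩
      have : (⟨0, zero_mem R⟩ : R) = 0 := rfl
      rw [this, map_zero, AddMonoidHom.zero_apply]
    · intro y hy x hx
      refine ⟨X.inv_mul_mem hy hx, ?_⟩
      let k : tensor N X.val.toUBimod →+ N := tlift (AddMonoidHom.mk' (fun a : X.val.carrier =>
        N.ract ⟨a * y, X.mul_inv_mem a.2 hy⟩) (fun a b => by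
          rw [← map_add]
          exact congrArg N.ract (Subtype.ext (add_mul (a : S) b y)))).flip (fun n r a => by
          change N.ract ⟨(a : S) * y, _⟩ (N.ract r n) = N.ract ⟨((r : S) * a) * y, _⟩ n
          rw [← N.ract_mul]
          exact congrArg (fun t => N.ract t n) (Subtype.ext (mul_assoc (r : S) (a : S) y).symm))
      have h1 : j (k z) = m z * y := thom_ext_apply (f := j.comp k)
        (g := (AddMonoidHom.mulRight y).comp m) (fun n (a : X.val.carrier) => by
          change j (N.ract ⟨a * y, _⟩ n) = m _ * y
          rw [hjr, hm, mul_assoc]) z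
      have h2 : (tensor N X.val.toUBimod).ract ⟨y * x, X.inv_mul_mem hy hx⟩ z =
          tmk N X.val.toUBimod (k z) (⟨x, hx⟩ : X.val.carrier) := thom_ext_apply
        (g := ((tmk N X.val.toUBimod).flip (⟨x, hx⟩ : X.val.carrier)).comp k)
        (fun n (a : X.val.carrier) => by
          change tmk N X.val.toUBimod n (⟨a * (y * x), _⟩ : X.val.carrier) =
            tmk N X.val.toUBimod (N.ract ⟨a * y, _⟩ n) (⟨x, hx⟩ : X.val.carrier)
          rw [tmk_bal]
          exact congrArg (fun t : X.val.carrier => tmk N X.val.toUBimod n t)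
            (Subtype.ext (mul_assoc (a : S) y x).symm)) z
      have h3 : k z = 0 := hj (by rw [h1, hz, zero_mul, map_zero])
      rw [h2, h3, map_zero, AddMonoidHom.zero_apply]
    · rintro v w ⟨hv, hv'⟩ ⟨hw, hw'⟩
      refine ⟨add_mem hv hw, ?_⟩
      have : (⟨v + w, add_mem hv hw⟩ : R) = ⟨v, hv⟩ + ⟨w, hw⟩ := rfl
      rw [this, map_add, AddMonoidHom.add_apply, hv', hw', add_zero]
  obtain ⟨e, -, h⟩ := (tensor N X.val.toUBimod).right_unital z
  obtain ⟨h1, h2⟩ := key e (by rw [inv_prod]; exact e.2)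
  rw [← h]
  exact h2

theorem barR_bijective : Function.Bijective (barR X.val.inclHom) := by
  refine ⟨X.injective_left (regS R E) (AddMonoidHom.id S) (fun _ _ h => h) (fun _ _ => rfl) _
    (fun _ _ => rfl), fun s => ?_⟩
  have key : ∀ w ∈ SubBimod.prod X.val.carrier X.inv.carrier,
      ∃ z, barR X.val.inclHom z = w * s := by
    intro w hw
    refine SubBimod.prod_induction (p := fun w => ∃ z, barR X.val.inclHom z = w * s) ?_ ?_ ?_ hw
    · exact ⟨0, by rw [map_zero, zero_mul]⟩
    · intro x hx y _
      exact ⟨tmk X.val.toUBimod (regS R E) (⟨x, hx⟩ : X.val.carrier) (y * s : S),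
        (mul_assoc x y s).symm⟩
    · rintro v w ⟨a, ha⟩ ⟨b, hb⟩
      exact ⟨a + b, by rw [map_add, ha, hb, add_mul]⟩
  obtain ⟨e, -, h, -⟩ := exists_unit_in E s
  obtain ⟨z, hz⟩ := key e (by rw [prod_inv]; exact e.2)
  exact ⟨z, by rw [hz, h]⟩

theorem barL_bijective : Function.Bijective (barL X.val.inclHom) := by
  refine ⟨X.injective_right (regS R E) (AddMonoidHom.id S) (fun _ _ h => h) (fun _ _ => rfl) _
    (fun _ _ => rfl), fun s => ?_⟩
  have key : ∀ w ∈ SubBimod.prod X.inv.carrier X.val.carrier,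
      ∃ z, barL X.val.inclHom z = s * w := by
    intro w hw
    refine SubBimod.prod_induction (p := fun w => ∃ z, barL X.val.inclHom z = s * w) ?_ ?_ ?_ hw
    · exact ⟨0, by rw [map_zero, mul_zero]⟩
    · intro y _ x hx
      exact ⟨tmk (regS R E) X.val.toUBimod (s * y : S) (⟨x, hx⟩ : X.val.carrier),
        mul_assoc s y x⟩
    · rintro v w ⟨a, ha⟩ ⟨b, hb⟩
      exact ⟨a + b, by rw [map_add, ha, hb, mul_add]⟩
  obtain ⟨e, -, -, h⟩ := exists_unit_in E s
  obtain ⟨z, hz⟩ := key e (by rw [inv_prod]; exact e.2)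
  exact ⟨z, by rw [hz, h]⟩

/-- The object `X ⊆ S` of `M(S/R)` given by an invertible `R`-subbimodule `X` of `S`. -/
noncomputable def toExtObj : ExtObj R E where
  P := X.val.toUBimod
  X := regular S (up R E)
  φ := X.val.inclHom
  bij_r := X.barR_bijective
  bij_l := X.barL_bijective

/-- The multiplication `X ⊗ W → X W`. -/
noncomputable def mulHom (W : SubBimod R E) :
    tensor X.val.toUBimod W.toUBimod →+ (X.val * W).carrier :=
  tlift (AddMonoidHom.mk' (fun x : X.val.carrier => AddMonoidHom.mk' (fun w : W.carrier =>
    (⟨x * w, SubBimod.mul_mem_prod x.2 w.2⟩ : (X.val * W).carrier))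
      (fun _ _ => Subtype.ext (mul_add _ _ _)))
      (fun _ _ => by ext w; exact add_mul _ _ _))
    (fun x r w => Subtype.ext (mul_assoc (x : S) (r : S) (w : S)))

theorem mulHom_bijective (W : SubBimod R E) : Function.Bijective (X.mulHom W) := by
  constructor
  · have : Function.Injective ((X.val * W).carrier.subtype.comp (X.mulHom W)) :=
      X.injective_left W.toUBimod W.carrier.subtype Subtype.val_injective (fun _ _ => rfl) _
        (fun _ _ => rfl)
    exact fun a b h => this (congrArg (X.val * W).carrier.subtype h)
  · rintro ⟨s, hs⟩
    have : ∃ z, (X.mulHom W z : S) = s := by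
      refine SubBimod.prod_induction (p := fun s => ∃ z, (X.mulHom W z : S) = s) ?_ ?_ ?_ hs
      · exact ⟨0, by rw [map_zero]; rfl⟩
      · intro x hx w hw
        exact ⟨tmk X.val.toUBimod W.toUBimod (⟨x, hx⟩ : X.val.carrier) (⟨w, hw⟩ : W.carrier), rfl⟩
      · rintro v w ⟨a, ha⟩ ⟨b, hb⟩
        exact ⟨a + b, by rw [map_add, ← ha, ← hb]; rfl⟩
    obtain ⟨z, hz⟩ := this
    exact ⟨z, Subtype.ext hz⟩

/-- The isomorphism `X ⊗ W ≅ X W`. -/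
noncomputable def mulIso (W : SubBimod R E) :
    UBimod.Iso (tensor X.val.toUBimod W.toUBimod) (X.val * W).toUBimod :=
  UBimod.Iso.ofBijective (N := (X.val * W).toUBimod) (X.mulHom W) (X.mulHom_bijective W)
    (fun a z => thom_ext_apply
      (f := (X.mulHom W).comp ((tensor X.val.toUBimod W.toUBimod).lact a))
      (g := ((X.val * W).toUBimod.lact a).comp (X.mulHom W))
      (fun (x : X.val.carrier) (w : W.carrier) => Subtype.ext (mul_assoc (a : S) (x : S) (w : S))) z)
    (fun a z => thom_ext_apply
      (f := (X.mulHom W).comp ((tensor X.val.toUBimod W.toUBimod).ract a))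
      (g := ((X.val * W).toUBimod.ract a).comp (X.mulHom W))
      (fun (x : X.val.carrier) (w : W.carrier) =>
        Subtype.ext (mul_assoc (x : S) (w : S) (a : S)).symm) z)

theorem of_mul (W : SubBimod R E) : BimodClass.of (X.val * W).toUBimod =
    BimodClass.of X.val.toUBimod * BimodClass.of W.toUBimod :=
  (Quotient.sound ⟨X.mulIso W⟩ : BimodClass.of (tensor X.val.toUBimod W.toUBimod) =
    BimodClass.of (X.val * W).toUBimod).symm

theorem of_one : BimodClass.of (1 : SubBimod R E).toUBimod = 1 := rfl

theorem isUnit_of : IsUnit (BimodClass.of X.val.toUBimod) := by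
  refine ⟨⟨BimodClass.of X.val.toUBimod, BimodClass.of X.inv.toUBimod, ?_, ?_⟩, rfl⟩
  · rw [← X.of_mul, X.val_inv, of_one]
  · have h := (X⁻¹).of_mul X.val
    have e : (X⁻¹).val = X.inv := rfl
    rw [e, X.inv_val, of_one] at h
    exact h.symm

end Inv

variable (R E) in
/-- The map `D' : Inv_R(S) → P(S/R)`, `X ↦ (X ⊆ S)`. -/
noncomputable def Dprime : Inv R E →* PSR R E where
  toFun X := ⟨ExtClass.of X.toExtObj, X.isUnit_of, isUnit_one⟩
  map_one' := rfl
  map_mul' X Y := Subtype.ext (Eq.symm (Quotient.sound ⟨⟨X.mulIso Y.val,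
    leftUnit (regular S (up R E)), thom_ext_apply
      (f := (leftUnit (regular S (up R E))).toAddEquiv.toAddMonoidHom.comp
        (ExtObj.chiHom X.toExtObj Y.toExtObj))
      (g := (X.val * Y.val).carrier.subtype.comp (X.mulHom Y.val))
      (fun _ _ => rfl)⟩⟩))

end Extension

/-! ## The group `Aut_{S-R}(S)` and the homomorphisms `D` and `λ ↦ λ̂` -/

section Aut

variable {S : Type u} [NonUnitalRing S]

/-- `Aut_{S-R}(S)`: the group of `S`-`R`-bilinear automorphisms of `S`. -/
@[ext] structure AutSR (R : NonUnitalSubring S) extends S ≃+ S where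
  map_left : ∀ s t, toFun (s * t) = s * toFun t
  map_right : ∀ t, ∀ r ∈ R, toFun (t * r) = toFun t * r

namespace AutSR

variable {R : NonUnitalSubring S}

instance : CoeFun (AutSR R) (fun _ => S → S) := ⟨fun f => f.toAddEquiv⟩

theorem map_l (f : AutSR R) (s t : S) : f (s * t) = s * f t := f.map_left s t

theorem map_r (f : AutSR R) (t : S) {r : S} (hr : r ∈ R) : f (t * r) = f t * r :=
  f.map_right t r hr

theorem ext' {f g : AutSR R} (h : ∀ s, f s = g s) : f = g := by
  have : f.toAddEquiv = g.toAddEquiv := AddEquiv.ext h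
  cases f; cases g
  cases this
  rfl

/-- The group structure is composition. -/
instance : Group (AutSR R) where
  mul f g :=
    { toAddEquiv := g.toAddEquiv.trans f.toAddEquiv
      map_left := fun s t => by
        change f (g (s * t)) = s * f (g t)
        rw [g.map_l, f.map_l]
      map_right := fun t r hr => by
        change f (g (t * r)) = f (g t) * r
        rw [g.map_r t hr, f.map_r _ hr] }
  one :=
    { toAddEquiv := AddEquiv.refl S
      map_left := fun _ _ => rfl
      map_right := fun _ _ _ => rfl }
  inv f :=
    { toAddEquiv := f.toAddEquiv.symm
      map_left := fun s t => by
        change f.toAddEquiv.symm (s * t) = s * f.toAddEquiv.symm t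
        rw [AddEquiv.symm_apply_eq, f.map_l, AddEquiv.apply_symm_apply]
      map_right := fun t r hr => by
        change f.toAddEquiv.symm (t * r) = f.toAddEquiv.symm t * r
        rw [AddEquiv.symm_apply_eq, f.map_r _ hr, AddEquiv.apply_symm_apply] }
  mul_assoc _ _ _ := rfl
  one_mul _ := rfl
  mul_one _ := rfl
  inv_mul_cancel f := ext' (fun s => f.toAddEquiv.symm_apply_apply s)

@[simp] theorem mul_apply (f g : AutSR R) (s : S) : (f * g) s = f (g s) := rfl

@[simp] theorem one_apply (s : S) : (1 : AutSR R) s = s := rfl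

@[simp] theorem inv_apply_self (f : AutSR R) (s : S) : f⁻¹ (f s) = s :=
  f.toAddEquiv.symm_apply_apply s

@[simp] theorem apply_inv_self (f : AutSR R) (s : S) : f (f⁻¹ s) = s :=
  f.toAddEquiv.apply_symm_apply s

/-- The image `λ(R)`. -/
def imageR (f : AutSR R) : AddSubgroup S := R.toAddSubgroup.map f.toAddEquiv.toAddMonoidHom

theorem mem_imageR (f : AutSR R) {s : S} : s ∈ f.imageR ↔ ∃ r ∈ R, f r = s := Iff.rfl

variable (E : Set R) [IsLocalUnits (up R E)]

/-- `λ(R)` as a unital `R`-subbimodule of `S`. -/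
def image (f : AutSR R) : SubBimod R E :=
  SubBimod.ofAddSubgroup f.imageR
    (by
      rintro r hr _ ⟨x, hx, rfl⟩
      exact ⟨r * x, R.mul_mem hr hx, f.map_l r x⟩)
    (by
      rintro r hr _ ⟨x, hx, rfl⟩
      exact ⟨x * r, R.mul_mem hx hr, f.map_r x hr⟩)

theorem image_mul (f g : AutSR R) : image E (f * g) = image E g * image E f := by
  apply SubBimod.ext
  rw [SubBimod.mul_carrier]
  apply le_antisymm
  · rintro _ ⟨r, hr, rfl⟩
    change f (g r) ∈ _
    obtain ⟨e, -, -, h⟩ := exists_unit_in E (g r)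
    rw [← h, f.map_l]
    exact SubBimod.mul_mem_prod ⟨r, hr, rfl⟩ ⟨e, e.2, rfl⟩
  · refine SubBimod.prod_le ?_
    rintro _ ⟨r, hr, rfl⟩ _ ⟨t, ht, rfl⟩
    refine ⟨r * t, R.mul_mem hr ht, ?_⟩
    change f (g (r * t)) = g r * f t
    rw [g.map_r r ht, f.map_l]

theorem image_one : image E (1 : AutSR R) = 1 := by
  apply SubBimod.ext
  ext s
  constructor
  · rintro ⟨r, hr, rfl⟩
    exact hr
  · intro hs
    exact ⟨s, hs, rfl⟩

/-- The homomorphism `D : Aut_{S-R}(S) → Inv_R(S)`, `λ ↦ λ⁻¹(R)`. -/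
def D : AutSR R →* Inv R E where
  toFun f := ⟨image E f⁻¹, image E f,
    by rw [← image_mul, mul_inv_cancel, image_one],
    by rw [← image_mul, inv_mul_cancel, image_one]⟩
  map_one' := Units.ext (by
    change image E (1 : AutSR R)⁻¹ = 1
    rw [inv_one, image_one])
  map_mul' f g := Units.ext (by
    change image E (f * g)⁻¹ = image E f⁻¹ * image E g⁻¹
    rw [mul_inv_rev, image_mul])

/-- The element `λ⁻¹(e) s λ(e)`, for a chosen `e ∈ Unit{s}`; by `hatFun_eq` it does not depend
on the choice of `e`. -/
noncomputable def hatFun (f : AutSR R) (s : S) : S :=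
  f⁻¹ (exists_mem_unitSet (up R E) s).choose * s * f (exists_mem_unitSet (up R E) s).choose

theorem hatFun_eq (f : AutSR R) {s e : S} (he : e ∈ unitSet (up R E) s) :
    hatFun E f s = f⁻¹ e * s * f e := by
  have key : ∀ e h : S, e ∈ unitSet (up R E) s → h * e = e → e * h = e →
      f⁻¹ h * s * f h = f⁻¹ e * s * f e := by
    rintro e h ⟨⟨e, -, rfl⟩, h1, h2⟩ h3 h4
    have a1 : f⁻¹ h * s = f⁻¹ (e : S) * s := by
      conv_lhs => rw [← h1]
      rw [← mul_assoc, ← (f⁻¹).map_r h e.2, h3]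
    have a2 : s * f h = s * f e := by
      conv_lhs => rw [← h2]
      rw [mul_assoc, ← f.map_l, h4]
    rw [a1, mul_assoc, a2, ← mul_assoc]
  have hc := (exists_mem_unitSet (up R E) s).choose_spec
  obtain ⟨h, -, ⟨h1, h2⟩, h3, h4⟩ :=
    exists_unit_two (up R E) e (exists_mem_unitSet (up R E) s).choose
  unfold hatFun
  rw [← key _ h hc h3 h4, ← key e h he h1 h2]

theorem apply_mul_inv_apply (f : AutSR R) {e : S} (he : e ∈ up R E) : f e * f⁻¹ e = e := by
  have hee := IsLocalUnits.idem (E := up R E) e he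
  obtain ⟨e, -, rfl⟩ := he
  rw [← (f⁻¹).map_l, ← f.map_r _ e.2, hee, inv_apply_self]

theorem hatFun_mul (f g : AutSR R) (s : S) : hatFun E (f * g) s = hatFun E f (hatFun E g s) := by
  obtain ⟨e, he⟩ := exists_mem_unitSet (up R E) s
  have heR : e ∈ R := by
    obtain ⟨⟨e, -, rfl⟩, -⟩ := he
    exact e.2
  have hee := IsLocalUnits.idem (E := up R E) e he.1
  have h1 : e * g⁻¹ e = g⁻¹ e := by rw [← (g⁻¹).map_l, hee]
  have h2 : g e * e = g e := by rw [← g.map_r e heR, hee]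
  have h3 : f⁻¹ e * e = f⁻¹ e := by rw [← (f⁻¹).map_r e heR, hee]
  have he' : e ∈ unitSet (up R E) (hatFun E g s) := by
    rw [hatFun_eq E g he]
    refine ⟨he.1, ?_, ?_⟩
    · rw [← mul_assoc, ← mul_assoc, h1]
    · rw [mul_assoc, h2]
  rw [hatFun_eq E _ he, hatFun_eq E f he', hatFun_eq E g he, mul_inv_rev, mul_apply, mul_apply]
  have k1 : g⁻¹ (f⁻¹ e) = f⁻¹ e * g⁻¹ e := by
    conv_lhs => rw [← h3]
    rw [(g⁻¹).map_l]
  have k2 : f (g e) = g e * f e := by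
    conv_lhs => rw [← h2]
    rw [f.map_l]
  rw [k1, k2]
  simp only [mul_assoc]

theorem hatFun_one (s : S) : hatFun E (1 : AutSR R) s = s := by
  obtain ⟨e, he⟩ := exists_mem_unitSet (up R E) s
  rw [hatFun_eq E _ he, inv_one, one_apply, he.2.1, he.2.2]

theorem hatFun_map_add (f : AutSR R) (s t : S) :
    hatFun E f (s + t) = hatFun E f s + hatFun E f t := by
  obtain ⟨e, he, hs, ht⟩ := exists_unit_two (up R E) s t
  rw [hatFun_eq E f ⟨he, hs⟩, hatFun_eq E f ⟨he, ht⟩,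
    hatFun_eq E f ⟨he, by rw [mul_add, hs.1, ht.1], by rw [add_mul, hs.2, ht.2]⟩,
    mul_add, add_mul]

theorem hatFun_map_mul (f : AutSR R) (s t : S) :
    hatFun E f (s * t) = hatFun E f s * hatFun E f t := by
  obtain ⟨e, he, hs, ht⟩ := exists_unit_two (up R E) s t
  rw [hatFun_eq E f ⟨he, hs⟩, hatFun_eq E f ⟨he, ht⟩,
    hatFun_eq E f ⟨he, by rw [← mul_assoc, hs.1], by rw [mul_assoc, ht.2]⟩]
  have : f⁻¹ e * s * f e * (f⁻¹ e * t * f e) = f⁻¹ e * s * (f e * f⁻¹ e) * t * f e := by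
    simp only [mul_assoc]
  rw [this, apply_mul_inv_apply E f he, mul_assoc (f⁻¹ e) s e, hs.2, mul_assoc (f⁻¹ e) s t]

theorem hatFun_of_mem (f : AutSR R) {r : S} (hr : r ∈ R) : hatFun E f r = r := by
  obtain ⟨e, he⟩ := exists_mem_unitSet (up R E) r
  rw [hatFun_eq E f he, ← (f⁻¹).map_r e hr, he.2.1, ← f.map_l]
  obtain ⟨⟨e, -, rfl⟩, -, h⟩ := he
  rw [← (f⁻¹).map_r r e.2, h, apply_inv_self]

end AutSR

/-- `Aut_{R-rings}(S)`: the group of ring automorphisms of `S` acting as the identity on `R`. -/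
def AutRings (R : NonUnitalSubring S) : Subgroup (RingAut S) where
  carrier := {φ | ∀ r ∈ R, φ r = r}
  mul_mem' := by
    intro φ ψ hφ hψ r hr
    change φ (ψ r) = r
    rw [hψ r hr, hφ r hr]
  one_mem' := fun _ _ => rfl
  inv_mem' := by
    intro φ hφ r hr
    change φ.symm r = r
    rw [RingEquiv.symm_apply_eq, hφ r hr]

/-- The homomorphism `Aut_{S-R}(S) → Aut_{R-rings}(S)`, `λ ↦ λ̂`, where
`λ̂(s) = λ⁻¹(e) s λ(e)` for `e ∈ Unit{s}`. -/
noncomputable def AutSR.hat {R : NonUnitalSubring S} (E : Set R) [IsLocalUnits (up R E)] :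
    AutSR R →* AutRings R where
  toFun f :=
    ⟨{ toFun := hatFun E f
       invFun := hatFun E f⁻¹
       left_inv := fun s => by rw [← hatFun_mul, inv_mul_cancel, hatFun_one]
       right_inv := fun s => by rw [← hatFun_mul, mul_inv_cancel, hatFun_one]
       map_mul' := hatFun_map_mul E f
       map_add' := hatFun_map_add E f }, fun _ hr => hatFun_of_mem E f hr⟩
  map_one' := Subtype.ext (RingEquiv.ext (fun s => hatFun_one E s))
  map_mul' f g := Subtype.ext (RingEquiv.ext (fun s => hatFun_mul E f g s))

end Aut

end LocUnits

/-!
The group property of `P(S/R)` and both nontrivial exactness statements rest on one tool: mutually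
inverse bimodules `M`, `N` admit isomorphisms `M ⊗ N ≅ A` and `N ⊗ M ≅ A` satisfying the triangle
identities (`UBimod.exists_invContext`). They amount to pairings `M × N → A` and `N × M → A`, which
are nondegenerate and have values generating `A`, so that all further arguments can be made with
elements.

*`P(S/R)` is a group.* Let `φ : P ⇒ X` have `P` invertible with inverse `Q` and `X` invertible with
inverse `Y`. Since `X` is generated by `φ(P)` as a right `S`-module, each `q ∈ Q` gives a right
linear functional `φ(p) s ↦ ⟨q, p⟩ s` on `X`, and such functionals are represented by elements
of `Y`. This defines `ψ : Q → Y` with `⟨ψ(q), φ(p)⟩ = ⟨q, p⟩` (`ExtObj.dualHom`), and faithfulness of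
`X` gives `⟨φ(p), ψ(q)⟩ = ⟨p, q⟩` as well. Expanding a local unit of `R` through the pairings
of `P` and `Q` then shows that `Q ⊗ S → Y` and `S ⊗ Q → Y` are bijective, and the pairings themselves
are the isomorphisms of `(P ⇒ X)(Q ⇒ Y)` and `(Q ⇒ Y)(P ⇒ X)` with `R ⇒ S`.

*Exactness at `Inv_R(S)`.* The kernel of `λ ↦ λ̂` consists of the `S`-bimodule automorphisms of `S`,
and such an automorphism `λ` identifies `V ⇒ S` with `R ⇒ S` exactly when `V = λ⁻¹(R)`.

*Exactness at `P(S/R)`.* If `X ≅ S`, then `Y ≅ S` in two ways, each turning one of the pairings of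
`X` and `Y` into the multiplication of `S`. Under these identifications the images of `Q` are a right
and a left inverse of the image `V` of `P`, so `V` is invertible, and `P → V` is bijective by
nondegeneracy (`ExtObj.exists_inv_of_pairing`).
-/

namespace LocUnits

/-! ### Invertible bimodules and their evaluation pairings -/

namespace UBimod

theorem eq_zero_of_lact {A : Type u} [NonUnitalRing A] {E : Set A} (M : UBimod A E) {x : M}
    (h : ∀ a, M.lact a x = 0) : x = 0 := by
  obtain ⟨e, -, he⟩ := M.left_unital x
  rw [← he, h]

theorem eq_zero_of_ract {A : Type u} [NonUnitalRing A] {E : Set A} (M : UBimod A E) {x : M}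
    (h : ∀ a, M.ract a x = 0) : x = 0 := by
  obtain ⟨e, -, he⟩ := M.right_unital x
  rw [← he, h]

section Context

variable {A : Type u} [NonUnitalRing A] {E : Set A} [IsLocalUnits E]

/-- Mutually inverse bimodules `M` and `N`, with isomorphisms `M ⊗ N ≅ A` and `N ⊗ M ≅ A`
that satisfy the two triangle identities (a strict Morita context from `A` to itself). -/
structure InvContext (M N : UBimod A E) where
  l : Iso (tensor M N) (regular A E)
  r : Iso (tensor N M) (regular A E)
  tri_left : ∀ m n m', M.lact (l.toAddEquiv (tmk M N m n)) m' =
    M.ract (r.toAddEquiv (tmk N M n m')) m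
  tri_right : ∀ n m n', N.lact (r.toAddEquiv (tmk N M n m)) n' =
    N.ract (l.toAddEquiv (tmk M N m n')) n

namespace InvContext

variable {M N : UBimod A E}

/-- The context with the roles of the two bimodules exchanged. -/
def symm (c : InvContext M N) : InvContext N M where
  l := c.r
  r := c.l
  tri_left := c.tri_right
  tri_right := c.tri_left

/-- The pairing `M × N → A` given by the isomorphism `M ⊗ N ≅ A`. -/
noncomputable def ev (c : InvContext M N) : M →+ N →+ A :=
  (AddMonoidHom.compHom c.l.toAddEquiv.toAddMonoidHom).comp (tmk M N)

theorem l_tmk (c : InvContext M N) (m : M) (n : N) :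
    c.l.toAddEquiv (tmk M N m n) = c.ev m n := rfl

theorem ev_lact (c : InvContext M N) (a : A) (m : M) (n : N) :
    c.ev (M.lact a m) n = a * c.ev m n := c.l.map_l a (tmk M N m n)

theorem ev_ract (c : InvContext M N) (a : A) (m : M) (n : N) :
    c.ev m (N.ract a n) = c.ev m n * a := c.l.map_r a (tmk M N m n)

theorem ev_bal (c : InvContext M N) (a : A) (m : M) (n : N) :
    c.ev (M.ract a m) n = c.ev m (N.lact a n) := congrArg c.l.toAddEquiv (tmk_bal m a n)

/-- The first triangle identity, in terms of the pairings. -/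
theorem ev_lact' (c : InvContext M N) (m : M) (n : N) (m' : M) :
    M.lact (c.ev m n) m' = M.ract (c.symm.ev n m') m := c.tri_left m n m'

/-- The values of the pairing generate `A` additively. -/
theorem ev_induction (c : InvContext M N) {p : A → Prop} (h0 : p 0) (hev : ∀ m n, p (c.ev m n))
    (hadd : ∀ a b, p a → p b → p (a + b)) (a : A) : p a := by
  obtain ⟨z, rfl⟩ := c.l.toAddEquiv.surjective a
  induction z using tinduction with
  | h0 => rwa [map_zero]
  | hmk m n => exact hev m n
  | hadd x y hx hy => rw [map_add]; exact hadd _ _ hx hy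

/-- The pairing is nondegenerate in its second variable. -/
theorem eq_zero_of_ev (c : InvContext M N) {n : N} (h : ∀ m, c.ev m n = 0) : n = 0 := by
  refine eq_zero_of_lact N (c.symm.ev_induction ?_ ?_ ?_)
  · simp
  · intro n' m
    rw [c.symm.ev_lact']
    change N.ract (c.ev m n) n' = 0
    rw [h, map_zero, AddMonoidHom.zero_apply]
  · intro a b ha hb
    rw [map_add, AddMonoidHom.add_apply, ha, hb, add_zero]

/-- The pairing is nondegenerate in its first variable. -/
theorem eq_zero_of_ev_left (c : InvContext M N) {m : M} (h : ∀ n, c.ev m n = 0) : m = 0 := by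
  refine eq_zero_of_ract M (c.symm.ev_induction ?_ ?_ ?_)
  · simp
  · intro n m'
    rw [← c.ev_lact', h, map_zero, AddMonoidHom.zero_apply]
  · intro a b ha hb
    rw [map_add, AddMonoidHom.add_apply, ha, hb, add_zero]

end InvContext

/-- Given isomorphisms `l : M ⊗ N ≅ A` and `r₀ : N ⊗ M ≅ A`, the automorphism `u` of `M` with
`u (m · r₀ (n ⊗ m')) = l (m ⊗ n) · m'` measures the failure of the first triangle identity. -/
theorem exists_defect {M N : UBimod A E} (l : Iso (tensor M N) (regular A E))
    (r₀ : Iso (tensor N M) (regular A E)) : ∃ u : Iso M M, ∀ m n m',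
      u.toAddEquiv (M.ract (r₀.toAddEquiv (tmk N M n m')) m) =
        M.lact (l.toAddEquiv (tmk M N m n)) m' := by
  let f : Iso (tensor (tensor M N) M) M := (l.tensor (Iso.refl M)).trans (leftUnit M)
  let g : Iso (tensor (tensor M N) M) M :=
    (assoc M N M).trans (((Iso.refl M).tensor r₀).trans (rightUnit M))
  refine ⟨g.symm.trans f, fun m n m' => ?_⟩
  change f.toAddEquiv (g.toAddEquiv.symm (g.toAddEquiv (tmk _ M (tmk M N m n) m'))) = _
  rw [AddEquiv.symm_apply_apply]
  rfl

/-- An inverse of an invertible bimodule can be equipped with isomorphisms satisfying the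
triangle identities: correct one of the two by the defect of the first identity; the second
identity then follows from the first. -/
theorem exists_invContext {M N : UBimod A E} (l : Iso (tensor M N) (regular A E))
    (r₀ : Iso (tensor N M) (regular A E)) : Nonempty (InvContext M N) := by
  obtain ⟨u, hu⟩ := exists_defect l r₀
  let r : Iso (tensor N M) (regular A E) := ((Iso.refl N).tensor u).trans r₀
  have hr : ∀ n m, r.toAddEquiv (tmk N M n m) = r₀.toAddEquiv (tmk N M n (u.toAddEquiv m)) :=
    fun _ _ => rfl
  have h1 : ∀ m n m', M.lact (l.toAddEquiv (tmk M N m n)) m' =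
      M.ract (r.toAddEquiv (tmk N M n m')) m := by
    intro m n m'
    apply u.toAddEquiv.injective
    rw [hr, hu, u.map_l]
  refine ⟨⟨l, r, h1, fun n m n' => ?_⟩⟩
  -- Both sides have the same products with all elements of `M`, hence the same products with
  -- all elements of `N ⊗ M ≅ A`.
  rw [← sub_eq_zero]
  set d := N.lact (r.toAddEquiv (tmk N M n m)) n' - N.ract (l.toAddEquiv (tmk M N m n')) n with hd
  have h2 : ∀ m', tmk M N m' d = 0 := by
    intro m'
    apply l.toAddEquiv.injective
    rw [hd, map_sub, map_sub, map_zero, ← tmk_bal, ← h1, ← lact_tmk, ← ract_tmk, l.map_l, l.map_r]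
    exact sub_self _
  have h3 : ∀ z : tensor N M, tmk (tensor N M) N z d = 0 := by
    intro z
    induction z using tinduction with
    | h0 => simp
    | hmk n₁ m₁ =>
      apply (assoc N M N).toAddEquiv.injective
      rw [assoc_mk, h2, map_zero, map_zero]
    | hadd x y hx hy => rw [map_add, AddMonoidHom.add_apply, hx, hy, add_zero]
  refine eq_zero_of_lact N fun a => ?_
  have h4 : ((r.tensor (Iso.refl N)).trans (leftUnit N)).toAddEquiv
      (tmk (tensor N M) N (r.toAddEquiv.symm a) d) = N.lact a d := by
    change N.lact (r.toAddEquiv (r.toAddEquiv.symm a)) d = _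
    rw [AddEquiv.apply_symm_apply]
  rw [← h4, h3, map_zero]

end Context

end UBimod

theorem BimodClass.exists_invContext {A : Type u} [NonUnitalRing A] {E : Set A} [IsLocalUnits E]
    {M : UBimod A E} (h : IsUnit (BimodClass.of M)) :
    ∃ N, Nonempty (UBimod.InvContext M N) := by
  obtain ⟨v, hv⟩ := h
  obtain ⟨N, hN⟩ := Quotient.exists_rep (v⁻¹).val
  have hN : BimodClass.of N = (v⁻¹).val := hN
  have h1 : BimodClass.of M * BimodClass.of N = 1 := by rw [hN, ← hv, v.mul_inv]
  have h2 : BimodClass.of N * BimodClass.of M = 1 := by rw [hN, ← hv, v.inv_mul]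
  obtain ⟨l⟩ : Nonempty (UBimod.Iso (UBimod.tensor M N) (UBimod.regular A E)) := Quotient.exact h1
  obtain ⟨r⟩ : Nonempty (UBimod.Iso (UBimod.tensor N M) (UBimod.regular A E)) := Quotient.exact h2
  exact ⟨N, UBimod.exists_invContext l r⟩

/-! ### Inverses in the monoid of classes `P ⇒ X` -/

open UBimod

variable {S : Type u} [NonUnitalRing S] {R : NonUnitalSubring S} {E : Set R}
  [IsLocalUnits (up R E)]

namespace ExtObj

variable (O : ExtObj R E)

theorem induction_right {p : O.X → Prop} (h0 : p 0)
    (hφ : ∀ v s, p (O.X.ract s (O.φ.toAddMonoidHom v)))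
    (hadd : ∀ x y, p x → p y → p (x + y)) (x : O.X) : p x := by
  obtain ⟨z, rfl⟩ := O.bij_r.2 x
  induction z using tinduction with
  | h0 => rwa [map_zero]
  | hmk v s => exact hφ v s
  | hadd x y hx hy => rw [map_add]; exact hadd _ _ hx hy

section Inverse

variable {O} {Q : UBimod R E} {Y : UBimod S (up R E)} (c : InvContext O.P Q)
  (C : InvContext O.X Y)

/-- An element `y` of the inverse `Y` of `X` is determined by its pairings with `φ(P)`. -/
theorem eq_of_ev_φ {y y' : Y} (h : ∀ p, C.symm.ev y (O.φ.toAddMonoidHom p) =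
    C.symm.ev y' (O.φ.toAddMonoidHom p)) : y = y' := by
  rw [← sub_eq_zero]
  refine C.symm.eq_zero_of_ev_left (O.induction_right ?_ ?_ ?_)
  · rw [map_zero]
  · intro p s
    rw [C.symm.ev_ract, map_sub, AddMonoidHom.sub_apply, h, sub_self, zero_mul]
  · intro x x' hx hx'
    rw [map_add, hx, hx', add_zero]

/-- For `q` in the inverse `Q` of `P`, the right `S`-linear functional `X → S` that sends
`φ(p) s` to `⟨q, p⟩ s`. -/
theorem exists_functional (q : Q) : ∃ f : O.X →+ S,
    (∀ x s, f (O.X.ract s x) = f x * s) ∧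
      ∀ p, f (O.φ.toAddMonoidHom p) = (c.symm.ev q p : R) := by
  let g : tensor O.P (regS R E) →+ S := tlift (AddMonoidHom.mk' (fun p => AddMonoidHom.mulLeft
      ((c.symm.ev q p : R) : S)) (fun x y => by
        ext s
        change ((c.symm.ev q (x + y) : R) : S) * s =
          ((c.symm.ev q x : R) : S) * s + ((c.symm.ev q y : R) : S) * s
        rw [map_add, ← add_mul]; rfl))
    (fun p a s => by
      change ((c.symm.ev q (O.P.ract a p) : R) : S) * s =
        ((c.symm.ev q p : R) : S) * ((a : S) * s)
      rw [c.symm.ev_ract, ← mul_assoc]; rfl)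
  have hg : ∀ p s, g (tmk O.P (regS R E) p s) = ((c.symm.ev q p : R) : S) * s := fun _ _ => rfl
  let b : tensor O.P (regS R E) ≃+ O.X := AddEquiv.ofBijective _ O.bij_r
  let f : O.X →+ S := g.comp b.symm.toAddMonoidHom
  have hf : ∀ p (s : S), f (O.X.ract s (O.φ.toAddMonoidHom p)) =
      ((c.symm.ev q p : R) : S) * s := by
    intro p s
    change g (b.symm (b (tmk O.P (regS R E) p s))) = _
    rw [AddEquiv.symm_apply_apply, hg]
  refine ⟨f, fun x s => ?_, fun p => ?_⟩
  · refine O.induction_right (p := fun x => f (O.X.ract s x) = f x * s) ?_ ?_ ?_ x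
    · simp
    · intro p t
      rw [← O.X.ract_mul, hf, hf, mul_assoc]
    · intro x y hx hy
      rw [map_add, map_add, map_add, hx, hy, add_mul]
  · obtain ⟨e, he, h⟩ := O.exists_right_unit p
    rw [← h, hf]
    change ((c.symm.ev q p * e : R) : S) = _
    rw [← c.symm.ev_ract, he]

/-- Every element of `Q` acts on `φ(P)` like an element of `Y`. -/
theorem exists_dual (q : Q) : ∃ y : Y, ∀ p,
    C.symm.ev y (O.φ.toAddMonoidHom p) = (c.symm.ev q p : R) := by
  obtain ⟨f, hf, hfφ⟩ := exists_functional c q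
  have hbal : ∀ (x : O.X) (s : S) (y : Y), Y.lact (f (O.X.ract s x)) y =
      Y.lact (f x) (Y.lact s y) := fun x s y => by rw [hf, Y.lact_mul]
  let F : tensor O.X Y →+ Y := tlift (Y.lact.comp f) hbal
  -- For `w = ∑ xᵢ ⊗ yᵢ` the element `∑ f(xᵢ) yᵢ` of `Y` represents `x ↦ f(∑ ⟨xᵢ, yᵢ⟩ x)`.
  have key : ∀ w x, C.symm.ev (F w) x = f (O.X.lact (C.l.toAddEquiv w) x) := by
    intro w x
    induction w using tinduction with
    | h0 => simp
    | hmk x' y' =>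
      rw [C.l_tmk, C.ev_lact', hf, ← C.symm.ev_lact]
      rfl
    | hadd v w hv hw => simp only [map_add, AddMonoidHom.add_apply, hv, hw]
  obtain ⟨e, -, he⟩ := Q.right_unital q
  refine ⟨F (C.l.toAddEquiv.symm (e : S)), fun p => ?_⟩
  rw [key, AddEquiv.apply_symm_apply]
  have := O.φ.map_l e p
  change f (O.X.res.lact e (O.φ.toAddMonoidHom p)) = _
  rw [← this, hfφ, ← c.symm.ev_bal, he]

/-- The map `ψ : Q → Y` dual to `φ : P → X`, characterized by `⟨ψ(q), φ(p)⟩ = ⟨q, p⟩`. -/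
noncomputable def dualHom : Hom Q Y.res where
  toAddMonoidHom := AddMonoidHom.mk' (fun q => (exists_dual c C q).choose) (fun q q' => by
    refine eq_of_ev_φ C fun p => ?_
    rw [(exists_dual c C (q + q')).choose_spec, map_add, map_add, AddMonoidHom.add_apply,
      AddMonoidHom.add_apply, (exists_dual c C q).choose_spec, (exists_dual c C q').choose_spec]
    rfl)
  map_lact a q := by
    refine eq_of_ev_φ C fun p => ?_
    change C.symm.ev (exists_dual c C (Q.lact a q)).choose _ =
      C.symm.ev (Y.lact (a : S) (exists_dual c C q).choose) _
    rw [(exists_dual c C (Q.lact a q)).choose_spec, C.symm.ev_lact,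
      (exists_dual c C q).choose_spec, c.symm.ev_lact]
    rfl
  map_ract a q := by
    refine eq_of_ev_φ C fun p => ?_
    have h : O.φ.toAddMonoidHom (O.P.lact a p) = O.X.lact (a : S) (O.φ.toAddMonoidHom p) :=
      O.φ.map_l a p
    change C.symm.ev (exists_dual c C (Q.ract a q)).choose _ =
      C.symm.ev (Y.ract (a : S) (exists_dual c C q).choose) _
    rw [(exists_dual c C (Q.ract a q)).choose_spec, C.symm.ev_bal, ← h,
      (exists_dual c C q).choose_spec, c.symm.ev_bal]

theorem coev_dualHom (q : Q) (p : O.P) : C.symm.ev ((dualHom c C).toAddMonoidHom q)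
    (O.φ.toAddMonoidHom p) = (c.symm.ev q p : R) := (exists_dual c C q).choose_spec p

/-- The dual map also respects the pairings in the other order, because `X` is a faithful left
`S`-module generated by `φ(P)`. -/
theorem ev_dualHom (p : O.P) (q : Q) : C.ev (O.φ.toAddMonoidHom p)
    ((dualHom c C).toAddMonoidHom q) = (c.ev p q : R) := by
  rw [← sub_eq_zero]
  set t : S := C.ev (O.φ.toAddMonoidHom p) ((dualHom c C).toAddMonoidHom q) - (c.ev p q : R)
    with ht
  have h1 : ∀ x, O.X.lact t x = 0 := by
    refine O.induction_right ?_ ?_ ?_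
    · simp
    · intro p' s
      have h : O.φ.toAddMonoidHom (O.P.lact (c.ev p q) p') =
        O.X.lact ((c.ev p q : R) : S) (O.φ.toAddMonoidHom p') := O.φ.map_l _ p'
      have h' : O.φ.toAddMonoidHom (O.P.ract (c.symm.ev q p') p) =
        O.X.ract ((c.symm.ev q p' : R) : S) (O.φ.toAddMonoidHom p) := O.φ.map_r _ p
      rw [← O.X.act_comm, ht, map_sub, AddMonoidHom.sub_apply, C.ev_lact', coev_dualHom, ← h,
        ← h', c.ev_lact', sub_self, map_zero]
    · intro x y hx hy
      rw [map_add, hx, hy, add_zero]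
  have h2 : ∀ s : S, t * s = 0 := by
    refine C.ev_induction (mul_zero t) ?_ ?_
    · intro x y
      rw [← C.ev_lact, h1, map_zero, AddMonoidHom.zero_apply]
    · intro a b ha hb
      rw [mul_add, ha, hb, add_zero]
  obtain ⟨e, -, he⟩ := exists_mem_unitSet (up R E) t
  rw [← he.2, h2]

/-- The inverse map is `y ↦ ∑ qᵢ ⊗ ⟨φ(pᵢ), y⟩`, where `∑ ⟨qᵢ, pᵢ⟩` is a left local unit for `y`. -/
theorem dualHom_bij_r : Function.Bijective (barR (dualHom c C)) := by
  constructor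
  · rw [injective_iff_map_eq_zero]
    intro z hz
    refine eq_zero_of_lact _ (c.symm.ev_induction ?_ ?_ ?_)
    · rw [map_zero, AddMonoidHom.zero_apply]
    · intro q p
      have h : (tensor Q (regS R E)).lact (c.symm.ev q p) z =
          tmk Q (regS R E) q (C.ev (O.φ.toAddMonoidHom p) (barR (dualHom c C) z)) :=
        thom_ext_apply (g := (tmk Q (regS R E) q).comp ((C.ev (O.φ.toAddMonoidHom p)).comp
          (barR (dualHom c C)))) (fun q' s => by
            change tmk Q (regS R E) (Q.lact (c.symm.ev q p) q') s = tmk Q (regS R E) q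
              (C.ev (O.φ.toAddMonoidHom p) (Y.ract s ((dualHom c C).toAddMonoidHom q')))
            rw [c.symm.ev_lact', tmk_bal, C.ev_ract, ev_dualHom]
            rfl) z
      rw [h, hz, map_zero, map_zero]
    · intro a b ha hb
      rw [map_add, AddMonoidHom.add_apply, ha, hb, add_zero]
  · intro y
    have h : ∀ a : R, ∃ z, barR (dualHom c C) z = Y.res.lact a y := by
      refine c.symm.ev_induction ⟨0, ?_⟩ (fun q p => ?_) ?_
      · rw [map_zero, map_zero, AddMonoidHom.zero_apply]
      · refine ⟨tmk Q (regS R E) q (C.ev (O.φ.toAddMonoidHom p) y), ?_⟩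
        change _ = Y.lact ((c.symm.ev q p : R) : S) y
        rw [← coev_dualHom c C, C.symm.ev_lact']
        rfl
      · rintro a b ⟨z, hz⟩ ⟨w, hw⟩
        exact ⟨z + w, by rw [map_add, hz, hw, map_add, AddMonoidHom.add_apply]⟩
    obtain ⟨e, -, he⟩ := Y.res.left_unital y
    rw [← he]
    exact h e

/-- The inverse map is `y ↦ ∑ ⟨y, φ(pᵢ)⟩ ⊗ qᵢ`, where `∑ ⟨pᵢ, qᵢ⟩` is a right local unit for `y`. -/
theorem dualHom_bij_l : Function.Bijective (barL (dualHom c C)) := by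
  constructor
  · rw [injective_iff_map_eq_zero]
    intro z hz
    refine eq_zero_of_ract _ (c.ev_induction ?_ ?_ ?_)
    · rw [map_zero, AddMonoidHom.zero_apply]
    · intro p q
      have h : (tensor (regS R E) Q).ract (c.ev p q) z =
          tmk (regS R E) Q (C.symm.ev (barL (dualHom c C) z) (O.φ.toAddMonoidHom p)) q :=
        thom_ext_apply (g := ((tmk (regS R E) Q).flip q).comp
          ((C.symm.ev.flip (O.φ.toAddMonoidHom p)).comp (barL (dualHom c C)))) (fun s q' => by
            change tmk (regS R E) Q s (Q.ract (c.ev p q) q') = tmk (regS R E) Q (C.symm.ev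
              (Y.lact s ((dualHom c C).toAddMonoidHom q')) (O.φ.toAddMonoidHom p)) q
            have := c.symm.ev_lact' q' p q
            change _ = Q.ract (c.ev p q) q' at this
            rw [← this, ← tmk_bal, C.symm.ev_lact, coev_dualHom]
            rfl) z
      rw [h, hz, map_zero, AddMonoidHom.zero_apply, map_zero, AddMonoidHom.zero_apply]
    · intro a b ha hb
      rw [map_add, AddMonoidHom.add_apply, ha, hb, add_zero]
  · intro y
    have h : ∀ a : R, ∃ z, barL (dualHom c C) z = Y.res.ract a y := by
      refine c.ev_induction ⟨0, ?_⟩ (fun p q => ?_) ?_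
      · rw [map_zero, map_zero, AddMonoidHom.zero_apply]
      · refine ⟨tmk (regS R E) Q (C.symm.ev y (O.φ.toAddMonoidHom p)) q, ?_⟩
        change _ = Y.ract ((c.ev p q : R) : S) y
        rw [← ev_dualHom c C]
        exact C.symm.ev_lact' _ _ _
      · rintro a b ⟨z, hz⟩ ⟨w, hw⟩
        exact ⟨z + w, by rw [map_add, hz, hw, map_add, AddMonoidHom.add_apply]⟩
    obtain ⟨e, -, he⟩ := Y.res.right_unital y
    rw [← he]
    exact h e

/-- The inverse `Q ⇒ Y` of an object `P ⇒ X` with `P` and `X` invertible. -/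
noncomputable def dual : ExtObj R E where
  P := Q
  X := Y
  φ := dualHom c C
  bij_r := dualHom_bij_r c C
  bij_l := dualHom_bij_l c C

/-- The evaluations `P ⊗ Q ≅ R` and `X ⊗ Y ≅ S` form an isomorphism in `M(S/R)`. -/
noncomputable def mulDual : Iso (O.mul (dual c C)) (one R E) where
  α := c.l
  β := C.l
  comm := thom_ext_apply (f := C.l.toAddEquiv.toAddMonoidHom.comp (chiHom O (dual c C)))
    (g := (incl R).comp c.l.toAddEquiv.toAddMonoidHom) (ev_dualHom c C)

/-- The evaluations `Q ⊗ P ≅ R` and `Y ⊗ X ≅ S` form an isomorphism in `M(S/R)`. -/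
noncomputable def dualMul : Iso ((dual c C).mul O) (one R E) where
  α := c.r
  β := C.r
  comm := thom_ext_apply (f := C.r.toAddEquiv.toAddMonoidHom.comp (chiHom (dual c C) O))
    (g := (incl R).comp c.r.toAddEquiv.toAddMonoidHom) (coev_dualHom c C)

end Inverse

end ExtObj

/-- `P(S/R)` is a group. -/
theorem isUnit_PSR (c : PSR R E) : IsUnit c := by
  obtain ⟨⟨O⟩, hP, hX⟩ := c
  obtain ⟨Q, ⟨c⟩⟩ := BimodClass.exists_invContext (M := O.P) hP
  obtain ⟨Y, ⟨C⟩⟩ := BimodClass.exists_invContext (M := O.X) hX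
  have h1 : ExtClass.of O * ExtClass.of (ExtObj.dual c C) = 1 :=
    Quotient.sound ⟨ExtObj.mulDual c C⟩
  have h2 : ExtClass.of (ExtObj.dual c C) * ExtClass.of O = 1 :=
    Quotient.sound ⟨ExtObj.dualMul c C⟩
  let v : (ExtClass R E)ˣ := ⟨_, _, h1, h2⟩
  refine ⟨⟨⟨_, hP, hX⟩, ⟨ExtClass.of (ExtObj.dual c C), ?_, ?_⟩, Subtype.ext h1, Subtype.ext h2⟩,
    rfl⟩
  · exact (v⁻¹).isUnit.map (ExtClass.classP R E)
  · exact (v⁻¹).isUnit.map (ExtClass.classX R E)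

/-! ### Exactness at `Inv_R(S)` -/

namespace AutSR

/-- A bimodule automorphism of `S`, viewed in `Aut_{S-R}(S)`. -/
def ofIso (β : UBimod.Iso (regular S (up R E)) (regular S (up R E))) : AutSR R where
  toAddEquiv := β.toAddEquiv
  map_left s t := β.map_l s t
  map_right t r _ := β.map_r r t

theorem ofIso_mem_ker_hat (β : UBimod.Iso (regular S (up R E)) (regular S (up R E))) :
    ofIso β ∈ (hat (R := R) E).ker := by
  refine MonoidHom.mem_ker.2 (Subtype.ext (RingEquiv.ext fun s => ?_))
  obtain ⟨e, he⟩ := exists_mem_unitSet (up R E) s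
  have hβ : ∀ t s, ofIso β (t * s) = ofIso β t * s := fun t s => β.map_r s t
  change hatFun E (ofIso β) s = s
  rw [hatFun_eq E _ he, mul_assoc, ← map_l, he.2.2, ← map_l, hβ, apply_inv_self, he.2.1]

/-- An automorphism `λ` with trivial `λ̂` is given by `λ(s) = λ(e) s` for `e ∈ Unit{s}`. -/
theorem apply_eq_of_hat_eq_one {f : AutSR R} (hf : hat E f = 1) {e s : S}
    (he : e ∈ unitSet (up R E) s) : f s = f e * s := by
  have h : hatFun E f s = s := congrArg (fun φ : AutRings R => (φ : RingAut S) s) hf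
  rw [hatFun_eq E f he] at h
  conv_rhs => rw [← h]
  rw [← mul_assoc, ← mul_assoc, apply_mul_inv_apply E f he.1, he.2.1, ← map_l, he.2.2]

theorem map_mul_of_hat_eq_one {f : AutSR R} (hf : hat E f = 1) (s t : S) :
    f (s * t) = f s * t := by
  obtain ⟨h, hh, ⟨h1, h2⟩, h3, h4⟩ := exists_unit_two (up R E) s (s * t)
  rw [apply_eq_of_hat_eq_one (E := E) hf ⟨hh, h3, h4⟩,
    apply_eq_of_hat_eq_one (E := E) hf ⟨hh, h1, h2⟩, mul_assoc]

/-- An automorphism with trivial `λ̂`, as an automorphism of the `S`-bimodule `S`. -/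
def toIso (f : AutSR R) (hf : hat E f = 1) :
    UBimod.Iso (regular S (up R E)) (regular S (up R E)) where
  toAddEquiv := f.toAddEquiv
  map_lact s t := f.map_l s t
  map_ract s t := map_mul_of_hat_eq_one hf t s

theorem apply_mem_of_mem_D {f : AutSR R} {s : S} (hs : s ∈ (D E f).val.carrier) : f s ∈ R := by
  obtain ⟨r, hr, rfl⟩ := hs
  change f (f⁻¹ r) ∈ R
  rwa [apply_inv_self]

theorem mem_D {f : AutSR R} {s : S} : s ∈ (D E f).val.carrier ↔ f s ∈ R :=
  ⟨apply_mem_of_mem_D, fun h => ⟨f s, h, inv_apply_self f s⟩⟩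

/-- The isomorphism from `D(λ) ⇒ S` to `R ⇒ S` given by an automorphism `λ` with trivial `λ̂`. -/
noncomputable def extIso (f : AutSR R) (hf : hat E f = 1) :
    ExtObj.Iso (D E f).toExtObj (ExtObj.one R E) where
  α := UBimod.Iso.ofBijective (M := (D E f).val.toUBimod) (N := regular R E)
    (AddMonoidHom.mk' (fun s => (⟨f s, mem_D.1 s.2⟩ : R))
      (fun s t => Subtype.ext (map_add f.toAddEquiv (s : S) t)))
    ⟨fun s t h => Subtype.ext (f.toAddEquiv.injective (congrArg Subtype.val h)),
      fun r => ⟨⟨f⁻¹ r, mem_D.2 (by rw [apply_inv_self]; exact r.2)⟩,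
        Subtype.ext (apply_inv_self f r)⟩⟩
    (fun r s => Subtype.ext (f.map_l r s))
    (fun r s => Subtype.ext (f.map_r s r.2))
  β := toIso f hf
  comm _ := rfl

end AutSR

theorem mulExact_D_Dprime : Function.MulExact
    ((AutSR.D E).comp (AutSR.hat (R := R) E).ker.subtype) (Dprime R E) := by
  intro X
  constructor
  · intro h
    obtain ⟨i⟩ : Nonempty (ExtObj.Iso X.toExtObj (ExtObj.one R E)) :=
      Quotient.exact (congrArg Subtype.val h)
    refine ⟨⟨AutSR.ofIso i.β, AutSR.ofIso_mem_ker_hat i.β⟩, Units.ext (SubBimod.ext ?_)⟩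
    have hi : ∀ x : X.val.carrier, AutSR.ofIso i.β (x : S) =
        incl R (i.α.toAddEquiv x) := i.comm
    ext s
    refine AutSR.mem_D.trans ⟨fun hs => ?_, fun hs => ?_⟩
    · obtain ⟨x, hx⟩ := i.α.toAddEquiv.surjective (⟨_, hs⟩ : R)
      have h1 := hi x
      rw [hx] at h1
      rw [← (AutSR.ofIso i.β).toAddEquiv.injective h1]
      exact x.2
    · change AutSR.ofIso i.β s ∈ R
      rw [hi ⟨s, hs⟩]
      exact Subtype.property (p := (· ∈ R)) (i.α.toAddEquiv (⟨s, hs⟩ : X.val.carrier))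
  · rintro ⟨⟨f, hf⟩, rfl⟩
    exact Subtype.ext (Quotient.sound ⟨AutSR.extIso f hf⟩)

/-! ### Exactness at `P(S/R)` -/

namespace ExtObj

variable {O : ExtObj R E}

/-- The image in `S` of `P`, for an object `P ⇒ X` with a trivialization `X ≅ S`. -/
def range (j : UBimod.Iso O.X (regular S (up R E))) : SubBimod R E :=
  SubBimod.ofAddSubgroup (j.toAddEquiv.toAddMonoidHom.comp O.φ.toAddMonoidHom).range
    (by
      rintro r hr _ ⟨p, rfl⟩
      refine ⟨O.P.lact ⟨r, hr⟩ p, ?_⟩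
      exact (congrArg j.toAddEquiv (O.φ.map_l ⟨r, hr⟩ p)).trans (j.map_l r _))
    (by
      rintro r hr _ ⟨p, rfl⟩
      refine ⟨O.P.ract ⟨r, hr⟩ p, ?_⟩
      exact (congrArg j.toAddEquiv (O.φ.map_r ⟨r, hr⟩ p)).trans (j.map_r r _))

theorem mem_range (j : UBimod.Iso O.X (regular S (up R E))) (p : O.P) :
    (j.toAddEquiv (O.φ.toAddMonoidHom p) : S) ∈ (range j).carrier := ⟨p, rfl⟩

/-- If `P` and `Q` are inverse to each other, and the trivializations turn the products of their
images in `S` into the pairing `P × Q → R`, then these images multiply to `R`. -/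
theorem range_mul_range {O' : ExtObj R E} (c : InvContext O.P O'.P)
    (j : UBimod.Iso O.X (regular S (up R E))) (j' : UBimod.Iso O'.X (regular S (up R E)))
    (h : ∀ p q, (j.toAddEquiv (O.φ.toAddMonoidHom p) : S) *
      (j'.toAddEquiv (O'.φ.toAddMonoidHom q) : S) = (c.ev p q : R)) :
    range j * range j' = 1 := by
  refine SubBimod.ext (le_antisymm (SubBimod.prod_le ?_) fun r hr => ?_)
  · rintro _ ⟨p, rfl⟩ _ ⟨q, rfl⟩
    exact (h p q).symm ▸ (c.ev p q : R).2
  · refine c.ev_induction (p := fun r : R => (r : S) ∈ (range j * range j').carrier)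
      (zero_mem _) ?_ (fun a b => add_mem) ⟨r, hr⟩
    intro p q
    rw [← h]
    exact SubBimod.mul_mem_prod (mem_range j p) (mem_range j' q)

/-- A trivialization of `X` induces one of its inverse `Y`, turning the pairing `X × Y → S` into
the multiplication of `S`. -/
theorem exists_trivialization {X Y : UBimod S (up R E)} (C : InvContext X Y)
    (j : UBimod.Iso X (regular S (up R E))) : ∃ j' : UBimod.Iso Y (regular S (up R E)),
      ∀ x y, (j.toAddEquiv x : S) * (j'.toAddEquiv y : S) = C.ev x y := by
  let j' : UBimod.Iso Y (regular S (up R E)) :=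
    (leftUnit Y).symm.trans ((j.symm.tensor (Iso.refl Y)).trans C.l)
  refine ⟨j', fun x y => ?_⟩
  have h : j'.toAddEquiv ((leftUnit Y).toAddEquiv (tmk _ Y (j.toAddEquiv x) y)) =
      C.ev (j.toAddEquiv.symm (j.toAddEquiv x)) y := by
    change ((j.symm.tensor (Iso.refl Y)).trans C.l).toAddEquiv ((leftUnit Y).toAddEquiv.symm _) = _
    rw [AddEquiv.symm_apply_apply]
    rfl
  rw [AddEquiv.symm_apply_apply] at h
  rw [← h]
  exact (j'.map_l (j.toAddEquiv x) y).symm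

/-- As `exists_trivialization`, for the inverse on the other side. -/
theorem exists_trivialization_left {X Y : UBimod S (up R E)} (C : InvContext X Y)
    (j : UBimod.Iso X (regular S (up R E))) : ∃ j' : UBimod.Iso Y (regular S (up R E)),
      ∀ y x, (j'.toAddEquiv y : S) * (j.toAddEquiv x : S) = C.symm.ev y x := by
  let j' : UBimod.Iso Y (regular S (up R E)) :=
    (rightUnit Y).symm.trans (((Iso.refl Y).tensor j.symm).trans C.r)
  refine ⟨j', fun y x => ?_⟩
  have h : j'.toAddEquiv ((rightUnit Y).toAddEquiv (tmk Y _ y (j.toAddEquiv x))) =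
      C.symm.ev y (j.toAddEquiv.symm (j.toAddEquiv x)) := by
    change (((Iso.refl Y).tensor j.symm).trans C.r).toAddEquiv
      ((rightUnit Y).toAddEquiv.symm _) = _
    rw [AddEquiv.symm_apply_apply]
    rfl
  rw [AddEquiv.symm_apply_apply] at h
  rw [← h]
  exact (j'.map_r (j.toAddEquiv x) y).symm

/-- If `Q ⇒ Y` is inverse to `P ⇒ X`, in the strong sense that its map is compatible with the
pairings, and `X ≅ S`, then `P ⇒ X` comes from an invertible subbimodule of `S`, namely from the
image of `P`. -/
theorem exists_inv_of_pairing {O' : ExtObj R E} (c : InvContext O.P O'.P)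
    (C : InvContext O.X O'.X)
    (hev : ∀ p q, C.ev (O.φ.toAddMonoidHom p) (O'.φ.toAddMonoidHom q) = (c.ev p q : R))
    (hcoev : ∀ q p, C.symm.ev (O'.φ.toAddMonoidHom q) (O.φ.toAddMonoidHom p) =
      (c.symm.ev q p : R))
    (j : UBimod.Iso O.X (regular S (up R E))) :
    ∃ V : Inv R E, Nonempty (ExtObj.Iso V.toExtObj O) := by
  obtain ⟨k, hk⟩ := exists_trivialization C j
  obtain ⟨k', hk'⟩ := exists_trivialization_left C j
  have hr : ∀ p q, (j.toAddEquiv (O.φ.toAddMonoidHom p) : S) *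
      (k.toAddEquiv (O'.φ.toAddMonoidHom q) : S) = (c.ev p q : R) :=
    fun p q => (hk _ _).trans (hev p q)
  have h1 : range j * range k = 1 := range_mul_range c j k hr
  have h2 : range k' * range j = 1 :=
    range_mul_range c.symm k' j fun q p => (hk' _ _).trans (hcoev q p)
  have h3 : range k * range j = 1 := by rw [← left_inv_eq_right_inv h2 h1, h2]
  let V : Inv R E := ⟨range j, range k, h1, h3⟩
  let g : O.P →+ (range j).carrier :=
    (j.toAddEquiv.toAddMonoidHom.comp O.φ.toAddMonoidHom).rangeRestrict
  have hg : Function.Bijective g := by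
    refine ⟨(injective_iff_map_eq_zero g).2 fun p hp => ?_,
      AddMonoidHom.rangeRestrict_surjective _⟩
    have hp' : (j.toAddEquiv (O.φ.toAddMonoidHom p) : S) = 0 := congrArg Subtype.val hp
    refine c.eq_zero_of_ev_left fun q => Subtype.ext ?_
    rw [← hr, hp', zero_mul]
    rfl
  have hl : ∀ a p, g (O.P.lact a p) = (range j).toUBimod.lact a (g p) := fun a p =>
    Subtype.ext ((congrArg j.toAddEquiv (O.φ.map_l a p)).trans (j.map_l (a : S) _))
  have hr' : ∀ a p, g (O.P.ract a p) = (range j).toUBimod.ract a (g p) := fun a p =>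
    Subtype.ext ((congrArg j.toAddEquiv (O.φ.map_r a p)).trans (j.map_r (a : S) _))
  let i : ExtObj.Iso O V.toExtObj :=
    { α := UBimod.Iso.ofBijective (N := (range j).toUBimod) g hg hl hr'
      β := j
      comm := fun _ => rfl }
  exact ⟨V, (ExtObj.setoid R E).symm ⟨i⟩⟩

/-- An object `P ⇒ X` with `P` invertible and `X ≅ S` comes from an invertible subbimodule
of `S`. -/
theorem exists_inv (hP : IsUnit (BimodClass.of O.P))
    (j : UBimod.Iso O.X (regular S (up R E))) :
    ∃ V : Inv R E, Nonempty (ExtObj.Iso V.toExtObj O) := by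
  have hX : IsUnit (BimodClass.of O.X) := by
    have : BimodClass.of O.X = 1 := Quotient.sound ⟨j⟩
    rw [this]
    exact isUnit_one
  obtain ⟨Q, ⟨c⟩⟩ := BimodClass.exists_invContext hP
  obtain ⟨Y, ⟨C⟩⟩ := BimodClass.exists_invContext hX
  exact exists_inv_of_pairing (O' := dual c C) c C (ev_dualHom c C) (coev_dualHom c C) j

end ExtObj

theorem mulExact_Dprime_Or : Function.MulExact (Dprime R E) (Or R E) := by
  intro c
  have hc : ((Or R E c : Pic S (up R E)) : BimodClass S (up R E)) =
    ExtClass.classX R E c.val := rfl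
  constructor
  · intro h
    rw [h] at hc
    obtain ⟨⟨O⟩, hP, hX⟩ := c
    obtain ⟨j⟩ : Nonempty (UBimod.Iso O.X (regular S (up R E))) := Quotient.exact hc.symm
    obtain ⟨V, i⟩ := ExtObj.exists_inv (O := O) hP j
    exact ⟨V, Subtype.ext (Quotient.sound i)⟩
  · rintro ⟨V, rfl⟩
    exact Units.ext hc

end LocUnits

theorem mainTheorem4 {S : Type u} [NonUnitalRing S] (R : NonUnitalSubring S) (E : Set R)
    [LocUnits.IsLocalUnits (LocUnits.up R E)] :
    (∀ c : LocUnits.PSR R E, IsUnit c) ∧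
    Function.Injective (Subgroup.inclusion
      (inf_le_right : (LocUnits.AutSR.D E).ker ⊓ (LocUnits.AutSR.hat E).ker ≤
        (LocUnits.AutSR.hat E).ker)) ∧
    Function.MulExact
      (Subgroup.inclusion
        (inf_le_right : (LocUnits.AutSR.D E).ker ⊓ (LocUnits.AutSR.hat E).ker ≤
          (LocUnits.AutSR.hat E).ker))
      ((LocUnits.AutSR.D E).comp (LocUnits.AutSR.hat E).ker.subtype) ∧
    Function.MulExact
      ((LocUnits.AutSR.D E).comp (LocUnits.AutSR.hat E).ker.subtype)
      (LocUnits.Dprime R E) ∧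
    Function.MulExact (LocUnits.Dprime R E) (LocUnits.Or R E) := by
  refine ⟨LocUnits.isUnit_PSR, Subgroup.inclusion_injective _, fun f => ?_,
    LocUnits.mulExact_D_Dprime, LocUnits.mulExact_Dprime_Or⟩
  constructor
  · intro h
    exact ⟨⟨f.1, h, f.2⟩, rfl⟩
  · rintro ⟨g, rfl⟩
    exact g.2.1
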